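/- **Theorem (Unitary Extension Principle).** Let $n\ge 1$, $N\ge 0$, and let $A:\mathbb{R}^n\to\mathbb{R}^n$ be a linear map that is expansive (all its complex eigenvalues have absolute value greater than $1$) and satisfies $A(\mathbb{Z}^n)\subset\mathbb{Z}^n$. Let $A^*$ be its adjoint, $d_A=|\det A|$, and let $\Gamma=\{\mathbf p_0=\mathbf 0,\mathbf p_1,\dots,\mathbf p_{d_A-1}\}$ be a full collection of representatives of the cosets of $(A^*)^{-1}(\mathbb{Z}^n)/\mathbb{Z}^n$. Write $\widehat f(x)=\int f(t)e^{-2\pi i t\cdot x}\,dt$ for the Fourier transform, extended to $L^2(\mathbb{R}^n)$, and $(D_Af)(t)=d_A^{1/2}f(At)$, $(\tau_kf)(t)=f(t-k)$. Functions in $L^\infty(\mathbb{T}^n)$ are regarded as $\mathbb{Z}^n$-periodic functions on $\mathbb{R}^n$. For a linear map $B$ that is expansive, the origin is a *point of $B$-approximate continuity* of a function $f$ if there is a measurable set $E\subset\mathbb{R}^n$ of positive Lebesgue measure such that, for every $r>0$, $$\lim_{j\to\infty}\frac{|E\cap B^{-j}B_r|}{|B^{-j}B_r|}=1,\qquad B_r=\{x:|x|<r\},$$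 and $f(y)\to f(\mathbf 0)$ as $y\to \mathbf 0$ with $y\in E$. Let $\phi\in L^2(\mathbb{R}^n)$, where a representative of $\widehat\phi$ is chosen with $|\widehat\phi(\mathbf 0)|=1$, be such that the origin is a point of $A^*$-approximate continuity of $|\widehat\phi|$ and $$\widehat\phi(A^*t)=H_0(t)\,\widehat\phi(t)\quad\text{for a.e. }t\in\mathbb{R}^n,$$ with $H_0\in L^\infty(\mathbb{T}^n)$. Let $\mathcal N_{\widehat\phi}=\{t\in\mathbb{R}^n:\sum_{k\in\mathbb{Z}^n}|\widehat\phi(t+k)|^2=0\}$, and let $H_1,\dots,H_N\in L^\infty(\mathbb{T}^n)$ be such that $$|H_0(t)|^2+\sum_{\ell=1}^N|H_\ell(t)|^2=1\quad\text{for a.e. }t\in\mathbb{R}^n\setminus\mathcal N_{\widehat\phi},$$ and such that, for a.e. $t\in\mathbb{R}^n\setminus\mathcal N_{\widehat\phi}$ and every $k=1,\dots,d_A-1$ with $t+\mathbf p_k\in\mathbb{R}^n\setminus\mathcal N_{\widehat\phi}$, $$H_0(t)\overline{H_0(t+\mathbf p_k)}+\sum_{\ell=1}^N H_\ell(t)\overline{H_\ell(t+\mathbf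 p_k)}=0.$$ Let $\psi_1,\dots,\psi_N\in L^2(\mathbb{R}^n)$ be defined by $\widehat{\psi_\ell}(A^*t)=H_\ell(t)\widehat\phi(t)$ for a.e. $t$. Then $\{\psi_1,\dots,\psi_N\}$ is a Parseval wavelet frame for $L^2(\mathbb{R}^n)$ associated to $A$; that is, the affine system $\{D_A^j\tau_k\psi_\ell: j\in\mathbb{Z},\ k\in\mathbb{Z}^n,\ 1\le\ell\le N\}$ is a frame for $L^2(\mathbb{R}^n)$ with both frame bounds equal to $1$. -/

import Mathlib

open MeasureTheory Filter Topology
open scoped ENNReal FourierTransform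

namespace Wavelet

/-- `ℝⁿ` with its Euclidean norm and inner product. -/
abbrev Rn (n : ℕ) : Type := EuclideanSpace ℝ (Fin n)

/-- The Hilbert space `L²(ℝⁿ)` of complex-valued functions, for Lebesgue measure. -/
abbrev L2 (n : ℕ) : Type := Lp ℂ 2 (volume : Measure (Rn n))

/-- The vector of `ℝⁿ` with integer coordinates `k`. -/
noncomputable def intVec {n : ℕ} (k : Fin n → ℤ) : Rn n :=
  WithLp.toLp 2 (fun i => (k i : ℝ))

/-- The lattice `ℤⁿ` inside `ℝⁿ`. -/
def intLattice (n : ℕ) : Set (Rn n) := Set.range intVec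

/-- `A` is expansive: every complex eigenvalue of `A` has absolute value greater than `1`. -/
def IsExpansive {n : ℕ} (A : Rn n →ₗ[ℝ] Rn n) : Prop :=
  ∀ z : ℂ, Module.End.HasEigenvalue (LinearMap.baseChange ℂ A) z → 1 < ‖z‖

theorem IsExpansive.injective {n : ℕ} {A : Rn n →ₗ[ℝ] Rn n} (hA : IsExpansive A) :
    Function.Injective A := by
  rw [injective_iff_map_eq_zero]
  intro v hv
  by_contra hne
  have hz : (1 : ℂ) ⊗ₜ[ℝ] v ≠ 0 := by
    intro h
    rw [Module.FaithfullyFlat.one_tmul_eq_zero_iff] at h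
    exact hne h
  have hev : Module.End.HasEigenvalue (LinearMap.baseChange ℂ A) (0 : ℂ) := by
    refine Module.End.hasEigenvalue_of_hasEigenvector (x := (1 : ℂ) ⊗ₜ[ℝ] v) ⟨?_, hz⟩
    rw [Module.End.mem_eigenspace_iff, LinearMap.baseChange_tmul, hv]
    simp
  have := hA 0 hev
  simp at this
  linarith

/-- An expansive linear map, as a linear automorphism of `ℝⁿ`. -/
noncomputable def IsExpansive.toLinearEquiv {n : ℕ} {A : Rn n →ₗ[ℝ] Rn n}
    (hA : IsExpansive A) : Rn n ≃ₗ[ℝ] Rn n :=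
  LinearEquiv.ofInjectiveEndo A hA.injective

theorem IsExpansive.toLinearEquiv_apply {n : ℕ} {A : Rn n →ₗ[ℝ] Rn n}
    (hA : IsExpansive A) (t : Rn n) : hA.toLinearEquiv t = A t := rfl

/-! ### Dilations and translations on `L²(ℝⁿ)` -/

/-- `d_T = |det T|`. -/
noncomputable def absDet {n : ℕ} (T : Rn n ≃ₗ[ℝ] Rn n) : ℝ :=
  |LinearMap.det (T : Rn n →ₗ[ℝ] Rn n)|

theorem absDet_pos {n : ℕ} (T : Rn n ≃ₗ[ℝ] Rn n) : 0 < absDet T :=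
  abs_pos.2 T.isUnit_det'.ne_zero

theorem absDet_mul_symm {n : ℕ} (T : Rn n ≃ₗ[ℝ] Rn n) : absDet T * absDet T.symm = 1 := by
  rw [absDet, absDet, ← abs_mul, LinearEquiv.det_mul_det_symm, abs_one]

theorem map_volume_linearEquiv {n : ℕ} (T : Rn n ≃ₗ[ℝ] Rn n) :
    Measure.map T (volume : Measure (Rn n)) = ENNReal.ofReal (absDet T)⁻¹ • volume := by
  have h := Measure.map_linearMap_addHaar_eq_smul_addHaar (volume : Measure (Rn n))
    (f := (T : Rn n →ₗ[ℝ] Rn n)) T.isUnit_det'.ne_zero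
  rw [abs_inv] at h
  exact h

theorem measurableEmbedding_linearEquiv {n : ℕ} (T : Rn n ≃ₗ[ℝ] Rn n) :
    MeasurableEmbedding T :=
  T.toContinuousLinearEquiv.toHomeomorph.measurableEmbedding

theorem quasiMeasurePreserving_linearEquiv {n : ℕ} (T : Rn n ≃ₗ[ℝ] Rn n) :
    Measure.QuasiMeasurePreserving T (volume : Measure (Rn n)) volume := by
  refine ⟨(measurableEmbedding_linearEquiv T).measurable, ?_⟩
  rw [map_volume_linearEquiv]
  exact Measure.smul_absolutelyContinuous

/-- The function `t ↦ d_T^{1/2} f (T t)`. -/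
noncomputable def dilateFun {n : ℕ} (T : Rn n ≃ₗ[ℝ] Rn n) (f : Rn n → ℂ) : Rn n → ℂ :=
  fun t => ((Real.sqrt (absDet T) : ℝ) : ℂ) * f (T t)

theorem eLpNorm_dilateFun {n : ℕ} (T : Rn n ≃ₗ[ℝ] Rn n) (f : Rn n → ℂ) :
    eLpNorm (dilateFun T f) 2 volume = eLpNorm f 2 volume := by
  have h1 : dilateFun T f = ((Real.sqrt (absDet T) : ℝ) : ℂ) • (f ∘ T) := rfl
  have hd := absDet_pos T
  rw [h1, eLpNorm_const_smul, ← (measurableEmbedding_linearEquiv T).eLpNorm_map_measure,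
    map_volume_linearEquiv, eLpNorm_smul_measure_of_ne_top (by simp), smul_eq_mul, ← mul_assoc]
  have h2 : ‖((Real.sqrt (absDet T) : ℝ) : ℂ)‖ₑ = ENNReal.ofReal (Real.sqrt (absDet T)) := by
    rw [← ofReal_norm, Complex.norm_real, Real.norm_of_nonneg (Real.sqrt_nonneg _)]
  have h3 : (ENNReal.ofReal (absDet T)⁻¹) ^ (1 / (2 : ℝ≥0∞)).toReal
      = ENNReal.ofReal (Real.sqrt (absDet T))⁻¹ := by
    rw [ENNReal.ofReal_rpow_of_pos (by positivity), ← Real.sqrt_inv, Real.sqrt_eq_rpow]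
    simp
  rw [h2, h3, ← ENNReal.ofReal_mul (Real.sqrt_nonneg _),
    mul_inv_cancel₀ (Real.sqrt_pos.2 hd).ne', ENNReal.ofReal_one, one_mul]

theorem memLp_dilateFun {n : ℕ} (T : Rn n ≃ₗ[ℝ] Rn n) {f : Rn n → ℂ}
    (hf : MemLp f 2 volume) : MemLp (dilateFun T f) 2 volume := by
  refine ⟨?_, by rw [eLpNorm_dilateFun]; exact hf.2⟩
  exact (hf.1.comp_quasiMeasurePreserving (quasiMeasurePreserving_linearEquiv T)).const_mul _

theorem dilateFun_congr {n : ℕ} (T : Rn n ≃ₗ[ℝ] Rn n) {f g : Rn n → ℂ}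
    (h : f =ᵐ[volume] g) : dilateFun T f =ᵐ[volume] dilateFun T g := by
  filter_upwards [(quasiMeasurePreserving_linearEquiv T).ae_eq_comp h] with t ht
  have ht' : f (T t) = g (T t) := ht
  simp only [dilateFun, ht']

theorem dilateFun_symm {n : ℕ} (T : Rn n ≃ₗ[ℝ] Rn n) (f : Rn n → ℂ) :
    dilateFun T.symm (dilateFun T f) = f := by
  funext t
  simp only [dilateFun, LinearEquiv.apply_symm_apply]
  rw [← mul_assoc, ← Complex.ofReal_mul, ← Real.sqrt_mul (absDet_pos _).le, mul_comm (absDet _),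
    absDet_mul_symm]
  simp

/-- The element of `L²(ℝⁿ)` given by `t ↦ d_T^{1/2} f (T t)`. -/
noncomputable def dilateL2 {n : ℕ} (T : Rn n ≃ₗ[ℝ] Rn n) (f : L2 n) : L2 n :=
  (memLp_dilateFun T (Lp.memLp f)).toLp (dilateFun T f)

theorem coeFn_dilateL2 {n : ℕ} (T : Rn n ≃ₗ[ℝ] Rn n) (f : L2 n) :
    dilateL2 T f =ᵐ[volume] dilateFun T f :=
  MemLp.coeFn_toLp _

theorem dilateL2_symm {n : ℕ} (T : Rn n ≃ₗ[ℝ] Rn n) (f : L2 n) :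
    dilateL2 T.symm (dilateL2 T f) = f := by
  apply Lp.ext
  refine (coeFn_dilateL2 _ _).trans ?_
  refine (dilateFun_congr T.symm (coeFn_dilateL2 T f)).trans ?_
  rw [dilateFun_symm]

/-- The unitary dilation operator `(D_T f)(t) = d_T^{1/2} f (T t)` on `L²(ℝⁿ)`.  Its inverse is
`D_{T⁻¹}`; integer powers are taken in the group of unitary operators. -/
noncomputable def dilation {n : ℕ} (T : Rn n ≃ₗ[ℝ] Rn n) : L2 n ≃ₗᵢ[ℂ] L2 n where
  toFun := dilateL2 T
  invFun := dilateL2 T.symm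
  left_inv := dilateL2_symm T
  right_inv := fun f => by
    have h := dilateL2_symm T.symm f
    rwa [LinearEquiv.symm_symm] at h
  map_add' := fun f g => by
    apply Lp.ext
    refine (coeFn_dilateL2 _ _).trans ((dilateFun_congr T (Lp.coeFn_add f g)).trans ?_)
    refine EventuallyEq.trans ?_ (Lp.coeFn_add _ _).symm
    filter_upwards [coeFn_dilateL2 T f, coeFn_dilateL2 T g] with t hf hg
    simp only [Pi.add_apply, hf, hg, dilateFun, mul_add]
  map_smul' := fun c f => by
    apply Lp.ext
    refine (coeFn_dilateL2 _ _).trans ((dilateFun_congr T (Lp.coeFn_smul c f)).trans ?_)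
    refine EventuallyEq.trans ?_ (Lp.coeFn_smul _ _).symm
    filter_upwards [coeFn_dilateL2 T f] with t hf
    simp only [RingHom.id_apply, Pi.smul_apply, hf, dilateFun, smul_eq_mul]
    ring
  norm_map' := fun f => by
    change ‖dilateL2 T f‖ = ‖f‖
    rw [dilateL2, Lp.norm_toLp, eLpNorm_dilateFun, Lp.norm_def]

theorem coeFn_dilation {n : ℕ} (T : Rn n ≃ₗ[ℝ] Rn n) (f : L2 n) :
    dilation T f =ᵐ[volume] fun t => ((Real.sqrt (absDet T) : ℝ) : ℂ) * f (T t) :=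
  coeFn_dilateL2 T f

/-- The translation `(τ_b f)(t) = f (t - b)` on `L²(ℝⁿ)`. -/
noncomputable def translation {n : ℕ} (b : Rn n) (f : L2 n) : L2 n :=
  Lp.compMeasurePreserving (fun t => t - b) (measurePreserving_sub_right volume b) f

theorem coeFn_translation {n : ℕ} (b : Rn n) (f : L2 n) :
    translation b f =ᵐ[volume] fun t => f (t - b) :=
  Lp.coeFn_compMeasurePreserving f (measurePreserving_sub_right volume b)

/-! ### Frames and affine systems -/

/-- The countable family `e` is a frame for the Hilbert space `H` with frame bounds `c`, `C`. -/
def IsFrameWithBounds {ι H : Type*} [NormedAddCommGroup H] [InnerProductSpace ℂ H]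
    (c C : ℝ) (e : ι → H) : Prop :=
  0 < c ∧ 0 < C ∧ ∀ h : H, Summable (fun i => ‖inner ℂ (e i) h‖ ^ 2) ∧
    c * ‖h‖ ^ 2 ≤ ∑' i, ‖inner ℂ (e i) h‖ ^ 2 ∧
    ∑' i, ‖inner ℂ (e i) h‖ ^ 2 ≤ C * ‖h‖ ^ 2

/-- A Parseval frame: a frame with both frame bounds equal to `1`. -/
def IsParsevalFrame {ι H : Type*} [NormedAddCommGroup H] [InnerProductSpace ℂ H]
    (e : ι → H) : Prop :=
  IsFrameWithBounds 1 1 e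

/-- The affine system `D_A^j τ_k ψ_ℓ`, `j ∈ ℤ`, `k ∈ ℤⁿ`, `1 ≤ ℓ ≤ N`. -/
noncomputable def affineSystem {n N : ℕ} (A : Rn n ≃ₗ[ℝ] Rn n) (ψ : Fin N → L2 n) :
    ℤ × (Fin n → ℤ) × Fin N → L2 n :=
  fun x => (dilation A ^ x.1) (translation (intVec x.2.1) (ψ x.2.2))

/-- `ψ_1, …, ψ_N` form a Parseval wavelet frame for `L²(ℝⁿ)` associated to the dilation `A`. -/
def IsParsevalWaveletFrame {n N : ℕ} (A : Rn n ≃ₗ[ℝ] Rn n) (ψ : Fin N → L2 n) : Prop :=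
  IsParsevalFrame (affineSystem A ψ)

/-! ### Approximate continuity along a dilation -/

/-- The set `B⁻ʲ(B_r) + x`, where `B_r` is the open ball of radius `r` about the origin;
`B` is meant to be invertible. -/
def shrunkBall {n : ℕ} (B : Rn n →ₗ[ℝ] Rn n) (j : ℕ) (r : ℝ) (x : Rn n) : Set (Rn n) :=
  {y | (B ^ j) (y - x) ∈ Metric.ball (0 : Rn n) r}

/-- `x` is a point of `B`-density for the (Lebesgue measurable) set `S`. -/
def IsDensityPoint {n : ℕ} (B : Rn n →ₗ[ℝ] Rn n) (S : Set (Rn n)) (x : Rn n) : Prop :=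
  ∀ r : ℝ, 0 < r → Tendsto
    (fun j : ℕ => volume (S ∩ shrunkBall B j r x) / volume (shrunkBall B j r x)) atTop (𝓝 1)

/-- `x` is a point of `B`-approximate continuity of `f`. -/
def IsApproxContinuousAt {n : ℕ} {Y : Type*} [TopologicalSpace Y] (B : Rn n →ₗ[ℝ] Rn n)
    (f : Rn n → Y) (x : Rn n) : Prop :=
  ∃ S : Set (Rn n), NullMeasurableSet S volume ∧ 0 < volume S ∧ IsDensityPoint B S x ∧
    Tendsto f (𝓝[S] x) (𝓝 (f x))

/-! ### Masks and the unitary extension identities -/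

/-- `H ∈ L^∞(𝕋ⁿ)`, seen as a `ℤⁿ`-periodic function on `ℝⁿ`. -/
def IsMask {n : ℕ} (H : Rn n → ℂ) : Prop :=
  MemLp H ∞ volume ∧ ∀ (k : Fin n → ℤ) (t : Rn n), H (t + intVec k) = H t

/-- `[g, g](t) = ∑_{k ∈ ℤⁿ} |g (t + k)|²`, a value in `[0, ∞]`. -/
noncomputable def bracket {n : ℕ} (g : Rn n → ℂ) (t : Rn n) : ℝ≥0∞ :=
  ∑' k : Fin n → ℤ, ‖g (t + intVec k)‖ₑ ^ 2

/-- `𝓝_g = {t : [g, g](t) = 0}`. -/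
def nullSet {n : ℕ} (g : Rn n → ℂ) : Set (Rn n) := {t | bracket g t = 0}

/-- `Γ` is a full collection of representatives of the cosets of `B⁻¹(ℤⁿ) / ℤⁿ`, containing
the origin as the representative of the trivial coset. -/
def IsCosetRepresentatives {n : ℕ} (B : Rn n →ₗ[ℝ] Rn n) (Γ : Set (Rn n)) : Prop :=
  0 ∈ Γ ∧ (∀ p ∈ Γ, B p ∈ intLattice n) ∧
    ∀ x : Rn n, B x ∈ intLattice n → ∃! p, p ∈ Γ ∧ x - p ∈ intLattice n

end Wavelet

/-! Let `T` be the adjoint of `A` and `g` the chosen representative of the transform of `φ`. For `f`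
whose transform has a continuous, compactly supported representative `F`, let V_j be the sum over k
of |⟨D^j τ_k φ, f⟩|², and W_j the same sum taken over all the ψ_ℓ. The proof rests on three facts:
V_{j+1} = V_j + W_j, V_j → ‖f‖² as j → ∞, and V_j → 0 as j → -∞. Telescoping then gives the Parseval
identity for such `f`, and density gives it for all of L².

On the Fourier side these coefficients are Fourier coefficients of a periodization, so V_j is a sum
of autocorrelations of conj g · D_T^j F over lattice points: the quantity `latticeEnergy`
(`hasSum_inner_dilation_translation`, resting on `hasSum_sq_fourier_lattice`).

The recursion is `sum_latticeEnergy_eq`. After the substitution t ↦ T t, the autocorrelations at k,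
summed over all masks, carry the factor ∑ m_i(t) conj m_i(t + T⁻¹k). It equals 1 when T⁻¹k is a
lattice vector and 0 otherwise, so only k in T(ℤⁿ) survive, and they rebuild the energy of `g`
against D_T F.

At small scales (`tendsto_latticeEnergy_dilateFun`) only the autocorrelation at 0 survives, namely ∫
|g(T⁻ʲt)|² |F(t)|² dt. The refinement equation makes |g| monotone along orbits, so approximate
continuity at the origin yields |g(T⁻ʲt)| → 1 almost everywhere, and dominated convergence applies.

At large scales (`tendsto_tsum_inner_translation`) decay is checked in the time domain for compactly
supported `f`, a different dense class. The two classes are reconciled by a Bessel bound: V_j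
increases to ‖f‖², so V_0 ≤ ‖f‖², and the decay extends to every `f` (`IsBessel.tendsto_of_dense`).
-/

namespace Wavelet

/-! ### Linear algebra of expansive maps -/

/-- In a complex Banach algebra, the powers of an element of spectral radius `< 1` tend to zero. -/
theorem tendsto_pow_of_spectrum_norm_lt_one {R : Type*} [NormedRing R] [NormedAlgebra ℂ R]
    [CompleteSpace R] [Nontrivial R] {a : R} (ha : ∀ z ∈ spectrum ℂ a, ‖z‖ < 1) :
    Tendsto (fun j : ℕ => a ^ j) atTop (𝓝 0) := by
  have h1 : spectralRadius ℂ a < (1 : NNReal) :=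
    spectrum.spectralRadius_lt_of_forall_lt a fun k hk => by
      have := ha k hk
      exact_mod_cast this
  obtain ⟨r, hr1, hr2⟩ := ENNReal.lt_iff_exists_nnreal_btwn.1 h1
  -- Gelfand's formula: the j-th root of the norm of `a ^ j` tends to the spectral radius, so the
  -- norm is eventually at most `r ^ j`.
  have h2 := spectrum.pow_nnnorm_pow_one_div_tendsto_nhds_spectralRadius a
  rw [tendsto_zero_iff_norm_tendsto_zero]
  have hr3 : (r : ℝ) < 1 := by exact_mod_cast hr2
  refine squeeze_zero' (Eventually.of_forall fun _ => norm_nonneg _) ?_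
    (tendsto_pow_atTop_nhds_zero_of_lt_one r.2 hr3)
  filter_upwards [h2.eventually_lt_const hr1, eventually_gt_atTop 0] with j hj hj0
  have hj' : (0 : ℝ) < j := by exact_mod_cast hj0
  have h3 : (((‖a ^ j‖₊ : ℝ≥0∞) ^ (1 / j : ℝ)) ^ (j : ℝ)) ≤ (r : ℝ≥0∞) ^ (j : ℝ) :=
    ENNReal.rpow_le_rpow hj.le hj'.le
  rw [← ENNReal.rpow_mul, one_div_mul_cancel hj'.ne', ENNReal.rpow_one, ENNReal.rpow_natCast] at h3
  exact_mod_cast h3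

-- Convergence is recorded entrywise, since the Banach algebra norm on matrices is only a local
-- instance. The index `i` makes the matrix ring nontrivial.
attribute [local instance] Matrix.linftyOpNormedRing Matrix.linftyOpNormedAlgebra in
theorem tendsto_matrix_pow {n : ℕ} {M : Matrix (Fin n) (Fin n) ℂ}
    (hM : ∀ z ∈ spectrum ℂ M, ‖z‖ < 1) (i k : Fin n) :
    Tendsto (fun j : ℕ => (M ^ j) i k) atTop (𝓝 0) := by
  have : Nonempty (Fin n) := ⟨i⟩
  have h := tendsto_pow_of_spectrum_norm_lt_one hM
  have h1 := ((continuous_apply k).comp (continuous_apply i)).tendsto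
    (0 : Matrix (Fin n) (Fin n) ℂ)
  exact h1.comp h

/-- Spectral values of an inverse are the inverses of spectral values, and in finite dimension the
latter are eigenvalues. -/
theorem IsExpansive.spectrum_symm {n : ℕ} {A : Rn n →ₗ[ℝ] Rn n} (hA : IsExpansive A) (z : ℂ)
    (hz : z ∈ spectrum ℂ (LinearMap.baseChange ℂ (hA.toLinearEquiv.symm : Rn n →ₗ[ℝ] Rn n))) :
    ‖z‖ < 1 := by
  let u : (Module.End ℂ (TensorProduct ℝ ℂ (Rn n)))ˣ :=
    { val := LinearMap.baseChange ℂ (hA.toLinearEquiv.symm : Rn n →ₗ[ℝ] Rn n)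
      inv := LinearMap.baseChange ℂ A
      val_inv := by
        rw [Module.End.mul_eq_comp, ← LinearMap.baseChange_comp]
        have : (hA.toLinearEquiv.symm : Rn n →ₗ[ℝ] Rn n) ∘ₗ A = LinearMap.id := by
          ext1 x
          exact hA.toLinearEquiv.symm_apply_apply x
        rw [this, LinearMap.baseChange_id]
        rfl
      inv_val := by
        rw [Module.End.mul_eq_comp, ← LinearMap.baseChange_comp]
        have : A ∘ₗ (hA.toLinearEquiv.symm : Rn n →ₗ[ℝ] Rn n) = LinearMap.id := by
          ext1 x
          exact hA.toLinearEquiv.apply_symm_apply x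
        rw [this, LinearMap.baseChange_id]
        rfl }
  have hz0 : z ≠ 0 := by
    rintro rfl
    exact spectrum.zero_notMem ℂ u.isUnit hz
  have h1 := (spectrum.inv_mem_iff (r := Units.mk0 z hz0) (a := u)).1 hz
  have h2 := hA _ (Module.End.hasEigenvalue_iff_mem_spectrum.2 h1)
  simp only [Units.val_inv_eq_inv_val, Units.val_mk0, norm_inv] at h2
  exact (one_lt_inv₀ (norm_pos_iff.2 hz0)).1 h2

/-- A linear automorphism of `ℝⁿ` as a continuous linear map. -/
noncomputable def toCLM {n : ℕ} (T : Rn n ≃ₗ[ℝ] Rn n) : Rn n →L[ℝ] Rn n :=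
  LinearMap.toContinuousLinearMap (T : Rn n →ₗ[ℝ] Rn n)

theorem toCLM_pow_apply {n : ℕ} (T : Rn n ≃ₗ[ℝ] Rn n) (j : ℕ) (x : Rn n) :
    (toCLM T ^ j) x = (T ^ j) x := by
  induction j generalizing x with
  | zero => rfl
  | succ j ih => rw [pow_succ, pow_succ]; exact ih _

/-- The negative powers of an expansive map tend to zero. -/
theorem IsExpansive.tendsto_symm_pow {n : ℕ} {A : Rn n →ₗ[ℝ] Rn n} (hA : IsExpansive A) :
    Tendsto (fun j : ℕ => toCLM hA.toLinearEquiv.symm ^ j) atTop (𝓝 0) := by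
  set S : Rn n →ₗ[ℝ] Rn n := (hA.toLinearEquiv.symm : Rn n →ₗ[ℝ] Rn n) with hS
  let b := (EuclideanSpace.basisFun (Fin n) ℝ).toBasis
  have h1 : ∀ j : ℕ, LinearMap.toMatrixAlgEquiv b (S ^ j) = LinearMap.toMatrixAlgEquiv b S ^ j :=
    fun j => map_pow _ _ _
  -- The real matrix is complexified to reach the complex spectrum; the entries of its powers stay
  -- real, so the limit descends.
  have hspec : ∀ z ∈ spectrum ℂ ((LinearMap.toMatrixAlgEquiv b S).map (algebraMap ℝ ℂ)),
      ‖z‖ < 1 := by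
    intro z hz
    have h2 := LinearMap.toMatrix_baseChange ℂ S b b
    have h3 : (LinearMap.toMatrixAlgEquiv b S).map (algebraMap ℝ ℂ)
        = LinearMap.toMatrixAlgEquiv (Algebra.TensorProduct.basis ℂ b)
          (LinearMap.baseChange ℂ S) := h2.symm
    rw [h3, AlgEquiv.spectrum_eq] at hz
    exact hA.spectrum_symm z hz
  have h4 : Tendsto (fun j : ℕ => LinearMap.toMatrixAlgEquiv b S ^ j) atTop (𝓝 0) := by
    refine tendsto_pi_nhds.2 fun i => tendsto_pi_nhds.2 fun k => ?_
    have h5 := tendsto_matrix_pow hspec i k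
    have h6 : ∀ j : ℕ, (((LinearMap.toMatrixAlgEquiv b S).map (algebraMap ℝ ℂ)) ^ j) i k
        = (((LinearMap.toMatrixAlgEquiv b S ^ j) i k : ℝ) : ℂ) := by
      intro j
      have := (map_pow (algebraMap ℝ ℂ).mapMatrix (LinearMap.toMatrixAlgEquiv b S) j)
      simp only [RingHom.mapMatrix_apply] at this
      rw [← this]
      rfl
    simp only [h6] at h5
    have h7 : Tendsto (fun j : ℕ => (LinearMap.toMatrixAlgEquiv b S ^ j) i k) atTop (𝓝 0) := by
      have h8 := (Complex.continuous_re.tendsto 0).comp h5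
      rw [Complex.zero_re] at h8
      exact h8
    exact h7
  let L : Matrix (Fin n) (Fin n) ℝ →ₗ[ℝ] (Rn n →L[ℝ] Rn n) :=
    (LinearMap.toContinuousLinearMap : (Rn n →ₗ[ℝ] Rn n) ≃ₗ[ℝ] (Rn n →L[ℝ] Rn n)).toLinearMap ∘ₗ
      (LinearMap.toMatrixAlgEquiv b).symm.toLinearMap
  have hL : Continuous L := L.continuous_of_finiteDimensional
  have h7 := (hL.tendsto 0).comp h4
  rw [map_zero] at h7
  have h8 : ∀ (j : ℕ) (x : Rn n), (S ^ j) x = (toCLM hA.toLinearEquiv.symm ^ j) x := by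
    intro j
    induction j with
    | zero => exact fun x => rfl
    | succ j ih => intro x; rw [pow_succ, pow_succ]; exact ih _
  refine h7.congr fun j => ?_
  ext1 x
  rw [← h8]
  change ((LinearMap.toMatrixAlgEquiv b).symm (LinearMap.toMatrixAlgEquiv b S ^ j)) x = _
  rw [← h1, AlgEquiv.symm_apply_apply]

/-! ### The adjoint -/

/-- The adjoint of a linear automorphism of `ℝⁿ`. -/
noncomputable def adjointEquiv {n : ℕ} (T : Rn n ≃ₗ[ℝ] Rn n) : Rn n ≃ₗ[ℝ] Rn n :=
  LinearEquiv.ofLinearMap (LinearMap.adjoint (T : Rn n →ₗ[ℝ] Rn n))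
    (LinearMap.adjoint (T.symm : Rn n →ₗ[ℝ] Rn n))
    (by rw [← LinearMap.adjoint_comp, LinearEquiv.symm_comp]; exact LinearMap.adjoint_id)
    (by rw [← LinearMap.adjoint_comp, LinearEquiv.comp_symm]; exact LinearMap.adjoint_id)

theorem inner_adjointEquiv {n : ℕ} (T : Rn n ≃ₗ[ℝ] Rn n) (x y : Rn n) :
    inner ℝ x (adjointEquiv T y) = inner ℝ (T x) y :=
  LinearMap.adjoint_inner_right (T : Rn n →ₗ[ℝ] Rn n) x y

theorem absDet_adjointEquiv {n : ℕ} (T : Rn n ≃ₗ[ℝ] Rn n) :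
    absDet (adjointEquiv T) = absDet T := by
  have h : ((adjointEquiv T : Rn n ≃ₗ[ℝ] Rn n) : Rn n →ₗ[ℝ] Rn n)
      = LinearMap.adjoint (T : Rn n →ₗ[ℝ] Rn n) := rfl
  let b := EuclideanSpace.basisFun (Fin n) ℝ
  rw [absDet, absDet, h, ← LinearMap.det_toMatrix b.toBasis, ← LinearMap.det_toMatrix b.toBasis,
    LinearMap.toMatrix_adjoint, Matrix.det_conjTranspose]
  simp

theorem toCLM_adjointEquiv_symm {n : ℕ} (T : Rn n ≃ₗ[ℝ] Rn n) :
    toCLM (adjointEquiv T).symm = ContinuousLinearMap.adjoint (toCLM T.symm) := rfl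

/-- Taking adjoints is continuous and commutes with powers, so the spectrum of the adjoint is not
needed. -/
theorem IsExpansive.tendsto_adjoint_symm_pow {n : ℕ} {A : Rn n →ₗ[ℝ] Rn n} (hA : IsExpansive A) :
    Tendsto (fun j : ℕ => toCLM (adjointEquiv hA.toLinearEquiv).symm ^ j) atTop (𝓝 0) := by
  have h := (ContinuousLinearMap.adjoint (𝕜 := ℝ) (E := Rn n) (F := Rn n)).continuous.tendsto 0
    |>.comp hA.tendsto_symm_pow
  rw [map_zero] at h
  refine h.congr fun j => ?_
  rw [toCLM_adjointEquiv_symm]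
  exact star_pow (toCLM hA.toLinearEquiv.symm) j

/-! ### The integer lattice -/

@[simp] theorem intVec_apply {n : ℕ} (k : Fin n → ℤ) (i : Fin n) : intVec k i = (k i : ℝ) := rfl

theorem intVec_injective {n : ℕ} : Function.Injective (intVec (n := n)) := by
  intro k l h
  funext i
  have := congrArg (fun v : Rn n => v i) h
  simpa using this

theorem intVec_add {n : ℕ} (k l : Fin n → ℤ) : intVec (k + l) = intVec k + intVec l := by
  ext i; simp

theorem intVec_neg {n : ℕ} (k : Fin n → ℤ) : intVec (-k) = -intVec k := by
  ext i; simp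

@[simp] theorem intVec_zero {n : ℕ} : intVec (0 : Fin n → ℤ) = 0 := by
  ext i; simp

theorem one_le_norm_intVec {n : ℕ} {k : Fin n → ℤ} (hk : k ≠ 0) : 1 ≤ ‖intVec k‖ := by
  obtain ⟨i, hi⟩ := Function.ne_iff.1 hk
  refine le_trans ?_ (PiLp.norm_apply_le (intVec k) i)
  rw [intVec_apply, Real.norm_eq_abs]
  exact_mod_cast Int.one_le_abs hi

/-- The adjoint of a map preserving the integer lattice preserves it too. -/
theorem adjoint_mem_intLattice {n : ℕ} {A : Rn n →ₗ[ℝ] Rn n}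
    (hAZ : ∀ k ∈ intLattice n, A k ∈ intLattice n) (k : Fin n → ℤ) :
    LinearMap.adjoint A (intVec k) ∈ intLattice n := by
  have h1 : ∀ i : Fin n, ∃ m : ℤ, (LinearMap.adjoint A (intVec k)) i = m := by
    intro i
    obtain ⟨l, hl⟩ := hAZ (intVec (Pi.single i 1)) ⟨_, rfl⟩
    refine ⟨∑ a, l a * k a, ?_⟩
    have h2 : (LinearMap.adjoint A (intVec k)) i
        = inner ℝ (intVec (Pi.single i 1)) (LinearMap.adjoint A (intVec k)) := by
      simp [PiLp.inner_apply, Pi.single_apply]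
    rw [h2, LinearMap.adjoint_inner_right, ← hl]
    simp [PiLp.inner_apply, mul_comm]
  choose m hm using h1
  exact ⟨m, by ext i; rw [hm]; rfl⟩

/-! ### Powers of dilations -/

theorem absDet_mul {n : ℕ} (S T : Rn n ≃ₗ[ℝ] Rn n) : absDet (S * T) = absDet S * absDet T := by
  rw [absDet, absDet, absDet, ← abs_mul, ← LinearMap.det_comp]
  rfl

theorem dilation_mul {n : ℕ} (S T : Rn n ≃ₗ[ℝ] Rn n) :
    dilation (S * T) = dilation T * dilation S := by
  ext1 f
  apply Lp.ext
  refine (coeFn_dilation _ _).trans ?_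
  refine EventuallyEq.trans ?_ (coeFn_dilation T (dilation S f)).symm
  have h := (quasiMeasurePreserving_linearEquiv T).ae_eq_comp (coeFn_dilation S f)
  filter_upwards [h] with t ht
  have ht' : dilation S f (T t) = ((Real.sqrt (absDet S) : ℝ) : ℂ) * f (S (T t)) := ht
  rw [ht', absDet_mul, Real.sqrt_mul (absDet_pos _).le]
  push_cast
  rw [LinearEquiv.mul_apply]
  ring

theorem dilation_one {n : ℕ} : dilation (1 : Rn n ≃ₗ[ℝ] Rn n) = 1 := by
  ext1 f
  apply Lp.ext
  refine (coeFn_dilation _ _).trans (Eventually.of_forall fun t => ?_)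
  have : absDet (1 : Rn n ≃ₗ[ℝ] Rn n) = 1 := by
    have h : ((1 : Rn n ≃ₗ[ℝ] Rn n) : Rn n →ₗ[ℝ] Rn n) = LinearMap.id := rfl
    rw [absDet, h, LinearMap.det_id, abs_one]
  simp [this]

/-- Dilation as an anti-homomorphism into the unitary group of `L²`. -/
noncomputable def dilationHom (n : ℕ) : (Rn n ≃ₗ[ℝ] Rn n) →* (L2 n ≃ₗᵢ[ℂ] L2 n)ᵐᵒᵖ where
  toFun T := MulOpposite.op (dilation T)
  map_one' := by rw [dilation_one]; rfl
  map_mul' S T := by rw [dilation_mul]; rfl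

theorem dilation_zpow {n : ℕ} (T : Rn n ≃ₗ[ℝ] Rn n) (j : ℤ) :
    dilation T ^ j = dilation (T ^ j) :=
  (congrArg MulOpposite.unop (map_zpow (dilationHom n) T j)).symm

theorem dilation_pow {n : ℕ} (T : Rn n ≃ₗ[ℝ] Rn n) (j : ℕ) :
    dilation T ^ j = dilation (T ^ j) := by
  simpa using dilation_zpow T j

/-! ### The Fourier transform of dilates and translates -/

theorem memLp_mul_of_norm_eq_one {n : ℕ} {m f : Rn n → ℂ} (hm : Continuous m)
    (hm1 : ∀ t, ‖m t‖ = 1) (hf : MemLp f 2 volume) : MemLp (fun t => m t * f t) 2 volume := by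
  refine hf.of_le (hm.aestronglyMeasurable.mul hf.1) (Eventually.of_forall fun t => ?_)
  rw [norm_mul, hm1, one_mul]

/-- Multiplication by a continuous unimodular function, on `L²(ℝⁿ)`. -/
noncomputable def modulation {n : ℕ} (m : Rn n → ℂ) (hm : Continuous m) (hm1 : ∀ t, ‖m t‖ = 1) :
    L2 n →ₗᵢ[ℂ] L2 n where
  toFun f := (memLp_mul_of_norm_eq_one hm hm1 (Lp.memLp f)).toLp (fun t => m t * f t)
  map_add' f g := by
    rw [← MemLp.toLp_add]
    refine MemLp.toLp_congr _ _ ?_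
    filter_upwards [Lp.coeFn_add f g] with t ht
    simp only [ht, Pi.add_apply, mul_add]
  map_smul' c f := by
    rw [RingHom.id_apply, ← MemLp.toLp_const_smul]
    refine MemLp.toLp_congr _ _ ?_
    filter_upwards [Lp.coeFn_smul c f] with t ht
    simp only [ht, Pi.smul_apply, smul_eq_mul]
    ring
  norm_map' f := by
    change ‖(memLp_mul_of_norm_eq_one hm hm1 (Lp.memLp f)).toLp (fun t => m t * f t)‖ = ‖f‖
    rw [Lp.norm_toLp, Lp.norm_def]
    congr 1
    exact eLpNorm_congr_norm_ae (Eventually.of_forall fun t => by rw [norm_mul, hm1, one_mul])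

theorem coeFn_modulation {n : ℕ} (m : Rn n → ℂ) (hm : Continuous m) (hm1 : ∀ t, ‖m t‖ = 1)
    (f : L2 n) : modulation m hm hm1 f =ᵐ[volume] fun t => m t * f t :=
  MemLp.coeFn_toLp (memLp_mul_of_norm_eq_one hm hm1 (Lp.memLp f))

theorem denseRange_schwartz {n : ℕ} :
    DenseRange (fun f : SchwartzMap (Rn n) ℂ => f.toLp 2 (volume : Measure (Rn n))) :=
  SchwartzMap.denseRange_toLpCLM (p := 2) (F := ℂ) (E := Rn n) (μ := volume) ENNReal.ofNat_ne_top

/-- The character `t ↦ e^{2πi x·t}`. -/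
noncomputable def character {n : ℕ} (x t : Rn n) : ℂ := (Real.fourierChar (inner ℝ x t) : ℂ)

@[simp] theorem norm_character {n : ℕ} (x t : Rn n) : ‖character x t‖ = 1 := Circle.norm_coe _

theorem continuous_character {n : ℕ} (x : Rn n) : Continuous (character x) := by
  unfold character
  exact continuous_subtype_val.comp
    (Real.continuous_fourierChar.comp (continuous_const.inner continuous_id))

theorem conj_character {n : ℕ} (x t : Rn n) :
    starRingEnd ℂ (character x t) = character (-x) t := by
  rw [character, character, inner_neg_left, AddChar.map_neg_eq_inv, Circle.coe_inv_eq_conj]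

/-- On Schwartz functions this is a substitution in the Fourier integral; both sides are continuous
on L², where Schwartz functions are dense. -/
theorem fourier_translation {n : ℕ} (b : Rn n) (f : L2 n) :
    (𝓕 (translation b f) : L2 n) =ᵐ[volume] fun t => character (-b) t * (𝓕 f : L2 n) t := by
  suffices h : (𝓕 (translation b f) : L2 n)
      = modulation (character (-b)) (continuous_character _) (norm_character _) (𝓕 f : L2 n) by
    rw [h]; exact coeFn_modulation _ _ _ _
  refine denseRange_schwartz.induction_on (p := fun f : L2 n => (𝓕 (translation b f) : L2 n)
      = modulation (character (-b)) (continuous_character _) (norm_character _) (𝓕 f : L2 n)) f ?_ ?_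
  · have h1 : Continuous (translation b : L2 n → L2 n) :=
      (Lp.compMeasurePreservingₗᵢ ℂ (fun t => t - b)
        (measurePreserving_sub_right volume b)).continuous
    exact isClosed_eq ((Lp.fourierTransformₗᵢ (Rn n) ℂ).continuous.comp h1)
      ((modulation _ _ _).continuous.comp (Lp.fourierTransformₗᵢ (Rn n) ℂ).continuous)
  · intro f
    have h1 : translation b (f.toLp 2) = (f.compSubConstCLM ℂ b).toLp 2 := by
      apply Lp.ext
      refine (coeFn_translation _ _).trans ?_
      refine EventuallyEq.trans ?_ (SchwartzMap.coeFn_toLp _ _ _).symm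
      exact (measurePreserving_sub_right volume b).quasiMeasurePreserving.ae_eq_comp
        (f.coeFn_toLp 2 volume)
    rw [h1, SchwartzMap.toLp_fourier_eq, SchwartzMap.toLp_fourier_eq]
    apply Lp.ext
    refine (SchwartzMap.coeFn_toLp _ _ _).trans ?_
    refine EventuallyEq.trans ?_ (coeFn_modulation _ _ _ _).symm
    filter_upwards [(𝓕 f).coeFn_toLp 2 volume] with t ht
    rw [ht, SchwartzMap.fourier_coe, SchwartzMap.fourier_coe, Real.fourier_eq, Real.fourier_eq,
      ← integral_const_mul]
    conv_rhs => rw [← integral_sub_right_eq_self _ b]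
    refine integral_congr_ae (Eventually.of_forall fun v => ?_)
    simp only [SchwartzMap.compSubConstCLM_apply, Circle.smul_def, smul_eq_mul, character]
    rw [← mul_assoc, ← Circle.coe_mul, ← AddChar.map_add_eq_mul, inner_sub_left, inner_neg_left]
    congr 3
    ring_nf

/-- Again checked on Schwartz functions. The Jacobian is the product of the two square roots carried
by the two dilations. -/
theorem dilation_adjoint_fourier_dilation {n : ℕ} (T : Rn n ≃ₗ[ℝ] Rn n) (f : L2 n) :
    dilation (adjointEquiv T) (𝓕 (dilation T f) : L2 n) = (𝓕 f : L2 n) := by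
  refine denseRange_schwartz.induction_on (p := fun f : L2 n =>
    dilation (adjointEquiv T) (𝓕 (dilation T f) : L2 n) = (𝓕 f : L2 n)) f ?_ ?_
  · exact isClosed_eq ((dilation _).continuous.comp
      ((Lp.fourierTransformₗᵢ (Rn n) ℂ).continuous.comp (dilation T).continuous))
      (Lp.fourierTransformₗᵢ (Rn n) ℂ).continuous
  · intro f
    set F : SchwartzMap (Rn n) ℂ := ((Real.sqrt (absDet T) : ℝ) : ℂ) •
      SchwartzMap.compCLMOfContinuousLinearEquiv ℂ T.toContinuousLinearEquiv f with hF
    have hFt : ∀ t, F t = ((Real.sqrt (absDet T) : ℝ) : ℂ) * f (T t) := fun t => rfl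
    have h1 : dilation T (f.toLp 2) = F.toLp 2 := by
      apply Lp.ext
      refine (coeFn_dilation _ _).trans ?_
      refine EventuallyEq.trans ?_ (SchwartzMap.coeFn_toLp _ _ _).symm
      exact dilateFun_congr T (f.coeFn_toLp 2 volume)
    rw [h1, SchwartzMap.toLp_fourier_eq, SchwartzMap.toLp_fourier_eq]
    apply Lp.ext
    refine (coeFn_dilation _ _).trans ?_
    refine EventuallyEq.trans ?_ (SchwartzMap.coeFn_toLp _ _ _).symm
    refine (dilateFun_congr _ ((𝓕 F).coeFn_toLp 2 volume)).trans (Eventually.of_forall fun t => ?_)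
    simp only [dilateFun]
    rw [SchwartzMap.fourier_coe, SchwartzMap.fourier_coe, Real.fourier_eq, Real.fourier_eq]
    have h2 : ∫ v, Real.fourierChar (-inner ℝ v t) • f v
        = (absDet T : ℂ) * ∫ v, Real.fourierChar (-inner ℝ (T v) t) • f (T v) := by
      have h3 := (measurableEmbedding_linearEquiv T).integral_map (μ := volume)
        (fun v => Real.fourierChar (-inner ℝ v t) • f v)
      rw [map_volume_linearEquiv, integral_smul_measure] at h3
      rw [← h3, ENNReal.toReal_ofReal (inv_nonneg.2 (absDet_pos T).le), Complex.real_smul,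
        ← mul_assoc, ← Complex.ofReal_mul, mul_inv_cancel₀ (absDet_pos T).ne']
      simp
    rw [h2, absDet_adjointEquiv]
    simp only [hFt, inner_adjointEquiv]
    simp_rw [Circle.smul_def, smul_eq_mul, mul_left_comm _ ((Real.sqrt (absDet T) : ℝ) : ℂ)]
    rw [integral_const_mul, ← mul_assoc, ← Complex.ofReal_mul, Real.mul_self_sqrt (absDet_pos T).le]

/-- The one-step identity says that dilation by the adjoint is the Fourier conjugate of the inverse
dilation, and conjugation commutes with integer powers. -/
theorem fourier_dilation_zpow {n : ℕ} (T : Rn n ≃ₗ[ℝ] Rn n) (j : ℤ) (f : L2 n) :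
    (dilation (adjointEquiv T) ^ j) (𝓕 ((dilation T ^ j) f) : L2 n) = (𝓕 f : L2 n) := by
  set U : L2 n ≃ₗᵢ[ℂ] L2 n := Lp.fourierTransformₗᵢ (Rn n) ℂ with hU
  have h : dilation (adjointEquiv T) = U * (dilation T)⁻¹ * U⁻¹ := by
    rw [eq_mul_inv_iff_mul_eq, eq_mul_inv_iff_mul_eq]
    ext1 f
    exact dilation_adjoint_fourier_dilation T f
  have h1 : dilation (adjointEquiv T) ^ j * (U * dilation T ^ j) = U := by
    rw [h, conj_zpow, inv_zpow]
    group
  exact DFunLike.congr_fun h1 f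

/-! ### Periodization over the unit cube -/

/-- The half-open unit cube `(-1/2, 1/2]ⁿ`. -/
def cube (n : ℕ) : Set (Rn n) := {t | ∀ i, t i ∈ Set.Ioc (-(1 / 2) : ℝ) (-(1 / 2) + 1)}

theorem measurableSet_cube (n : ℕ) : MeasurableSet (cube n) := by
  have h : cube n = ⋂ i : Fin n, {t : Rn n | t i ∈ Set.Ioc (-(1 / 2) : ℝ) (-(1 / 2) + 1)} := by
    ext t; simp [cube]
  rw [h]
  refine MeasurableSet.iInter fun i => ?_
  have hm : Measurable fun t : Rn n => t i := by fun_prop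
  exact hm measurableSet_Ioc

theorem existsUnique_add_intVec_mem_cube {n : ℕ} (t : Rn n) : ∃! k, t + intVec k ∈ cube n := by
  have h := fun i => existsUnique_add_zsmul_mem_Ioc (one_pos (α := ℝ)) (t i) (-(1 / 2))
  choose k hk hu using h
  refine ⟨k, fun i => ?_, fun l hl => funext fun i => hu i (l i) ?_⟩
  · have := hk i
    simpa using this
  · have := hl i
    simpa using this

theorem cube_subset_closedBall (n : ℕ) : ∃ R : ℝ, ∀ t ∈ cube n, ‖t‖ ≤ R := by
  refine ⟨∑ _i : Fin n, 1, fun t ht => ?_⟩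
  rw [EuclideanSpace.norm_eq]
  refine Real.sqrt_le_iff.2 ⟨by positivity, ?_⟩
  have h1 : ∑ i, ‖t i‖ ^ 2 ≤ ∑ _i : Fin n, (1 : ℝ) := by
    refine Finset.sum_le_sum fun i _ => ?_
    have := ht i
    rw [Real.norm_eq_abs, sq_abs]
    nlinarith [this.1, this.2]
  refine h1.trans ?_
  simp only [Finset.sum_const, Finset.card_univ, Fintype.card_fin, nsmul_eq_mul, mul_one]
  rcases Nat.eq_zero_or_pos n with h | h
  · simp [h]
  · have : (1 : ℝ) ≤ n := by exact_mod_cast h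
    nlinarith

theorem ball_subset_cube {n : ℕ} {t : Rn n} (ht : ‖t‖ < 1 / 2) : t ∈ cube n := by
  intro i
  have h := (PiLp.norm_apply_le t i).trans_lt ht
  rw [Real.norm_eq_abs, abs_lt] at h
  constructor <;> linarith [h.1, h.2]

theorem finite_norm_intVec_le (n : ℕ) (R : ℝ) : {k : Fin n → ℤ | ‖intVec k‖ ≤ R}.Finite := by
  refine (Set.finite_Icc (fun _ : Fin n => -⌈R⌉) (fun _ => ⌈R⌉)).subset fun k hk => ?_
  have h : ∀ i, |(k i : ℝ)| ≤ R := fun i => (PiLp.norm_apply_le (intVec k) i).trans hk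
  refine ⟨fun i => ?_, fun i => ?_⟩
  · have := (abs_le.1 (h i)).1
    have h2 := Int.le_ceil R
    have h3 : (-⌈R⌉ : ℝ) ≤ k i := by linarith
    exact_mod_cast h3
  · exact_mod_cast ((abs_le.1 (h i)).2.trans (Int.le_ceil R))

theorem iUnion_preimage_cube (n : ℕ) :
    ⋃ k : Fin n → ℤ, (fun t : Rn n => t + intVec k) ⁻¹' cube n = Set.univ :=
  Set.eq_univ_of_forall fun t => Set.mem_iUnion.2 (existsUnique_add_intVec_mem_cube t).exists

theorem pairwise_disjoint_preimage_cube (n : ℕ) : Pairwise (Function.onFun Disjoint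
    fun k : Fin n → ℤ => (fun t : Rn n => t + intVec k) ⁻¹' cube n) := by
  intro k l hkl
  rw [Function.onFun, Set.disjoint_left]
  intro t hk hl
  exact hkl ((existsUnique_add_intVec_mem_cube t).unique hk hl)

theorem measurableSet_preimage_cube {n : ℕ} (k : Fin n → ℤ) :
    MeasurableSet ((fun t : Rn n => t + intVec k) ⁻¹' cube n) :=
  (measurable_add_const _) (measurableSet_cube n)

theorem lintegral_eq_tsum_cube {n : ℕ} (f : Rn n → ℝ≥0∞) :
    ∫⁻ t, f t = ∑' k : Fin n → ℤ, ∫⁻ t in cube n, f (t + intVec k) := by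
  rw [← setLIntegral_univ, ← iUnion_preimage_cube,
    lintegral_iUnion measurableSet_preimage_cube (pairwise_disjoint_preimage_cube n),
    -- The piece brought into the cube by adding k is the cube translated by -k, hence the change of
    -- sign of the index.
    ← (Equiv.neg (Fin n → ℤ)).tsum_eq]
  refine tsum_congr fun k => ?_
  rw [← (measurePreserving_add_right volume (intVec (-k))).setLIntegral_comp_preimage_emb
    (measurableEmbedding_addRight _) (fun t => f (t + intVec k))]
  simp [intVec_neg]

theorem lintegral_eq_lintegral_cube {n : ℕ} {f : Rn n → ℝ≥0∞} (hf : AEMeasurable f volume) :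
    ∫⁻ t, f t = ∫⁻ t in cube n, ∑' k : Fin n → ℤ, f (t + intVec k) := by
  rw [lintegral_eq_tsum_cube, lintegral_tsum]
  intro k
  exact (hf.comp_quasiMeasurePreserving
    (measurePreserving_add_right volume (intVec k)).quasiMeasurePreserving).restrict

theorem hasSum_integral_cube {n : ℕ} {E : Type*} [NormedAddCommGroup E] [NormedSpace ℝ E]
    {u : Rn n → E} (hu : Integrable u volume) :
    HasSum (fun k : Fin n → ℤ => ∫ t in cube n, u (t + intVec k)) (∫ t, u t) := by
  have h := hasSum_integral_iUnion (f := u) (μ := (volume : Measure (Rn n)))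
    measurableSet_preimage_cube (pairwise_disjoint_preimage_cube n) hu.integrableOn
  rw [iUnion_preimage_cube, setIntegral_univ, ← (Equiv.neg (Fin n → ℤ)).hasSum_iff] at h
  refine h.congr_fun fun k => ?_
  have := (measurePreserving_add_right volume (intVec (-k))).setIntegral_preimage_emb
    (measurableEmbedding_addRight _) (fun t => u (t + intVec k)) (cube n)
  rw [← this]
  simp [intVec_neg]

theorem integral_cube_tsum {n : ℕ} {E : Type*} [NormedAddCommGroup E] [NormedSpace ℝ E]
    {u : Rn n → E} (hu : Integrable u volume) :
    ∫ t in cube n, ∑' k : Fin n → ℤ, u (t + intVec k) = ∫ t, u t := by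
  have h1 := hasSum_integral_cube hu
  have h2 := hasSum_integral_of_summable_integral_norm (μ := volume.restrict (cube n))
    (F := fun (k : Fin n → ℤ) t => u (t + intVec k))
    (fun k => (hu.comp_add_right (intVec k)).integrableOn) (hasSum_integral_cube hu.norm).summable
  exact h2.unique h1

/-! ### Fourier series: from the torus to the cube -/

section Torus

open UnitAddTorus

attribute [local instance] instMeasureSpaceUnitAddCircle

/-- The representative in the cube `(-1/2, 1/2]ⁿ` of a point of the torus. -/
noncomputable def torusRep {n : ℕ} (x : UnitAddTorus (Fin n)) : Rn n :=
  WithLp.toLp 2 (measurableEquivPiIoc (fun _ : Fin n => (-(1 / 2) : ℝ)) x).1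

theorem measurePreserving_torusRep (n : ℕ) :
    MeasurePreserving (torusRep (n := n)) volume (volume.restrict (cube n)) := by
  have h1 := measurePreserving_equivPiIoc (fun _ : Fin n => (-(1 / 2) : ℝ))
  have hm : MeasurableSet {x : Fin n → ℝ | ∀ i, x i ∈ Set.Ioc (-(1 / 2) : ℝ) (-(1 / 2) + 1)} :=
    MeasurableSet.univ_pi' fun i => measurableSet_Ioc
  have h2 := measurePreserving_subtype_coe (μa := (volume : Measure (Fin n → ℝ))) hm
  have h3 := (PiLp.volume_preserving_toLp (Fin n)).restrict_preimage (measurableSet_cube n)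
  exact h3.comp (h2.comp h1)

theorem mFourier_eq_character {n : ℕ} (k : Fin n → ℤ) (x : UnitAddTorus (Fin n)) :
    mFourier k x = character (intVec k) (torusRep x) := by
  have h1 : ∀ i, x i = ((torusRep x i : ℝ) : UnitAddCircle) := fun i => AddCircle.coe_equivIoc.symm
  have h2 : mFourier k x = ∏ i, fourier (k i) (x i) := rfl
  rw [h2, character, Real.fourierChar_apply, PiLp.inner_apply]
  conv_lhs => enter [2, i]; rw [h1 i, fourier_coe_apply]
  rw [← Complex.exp_sum]
  congr 1
  push_cast
  rw [Finset.mul_sum, Finset.sum_mul]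
  refine Finset.sum_congr rfl fun i _ => ?_
  simp
  ring

/-- **Parseval's identity** for Fourier series on the cube. -/
theorem hasSum_sq_fourier_cube {n : ℕ} {P : Rn n → ℂ}
    (hP : MemLp P 2 (volume.restrict (cube n))) :
    HasSum (fun k : Fin n → ℤ => ‖∫ t in cube n, character (intVec k) t * P t‖ ^ 2)
      (∫ t in cube n, ‖P t‖ ^ 2) := by
  have hπ := measurePreserving_torusRep n
  have hf : MemLp (P ∘ torusRep) 2 volume := hP.comp_measurePreserving hπ
  have h1 := hasSum_sq_mFourierCoeff (hf.toLp _)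
  have h2 : ∫ t, ‖(hf.toLp _) t‖ ^ 2 = ∫ t in cube n, ‖P t‖ ^ 2 := by
    rw [← hπ.map_eq, integral_map hπ.measurable.aemeasurable
      (by rw [hπ.map_eq]; exact (hP.1.norm.pow 2))]
    refine integral_congr_ae ?_
    filter_upwards [hf.coeFn_toLp] with t ht
    rw [ht]; rfl
  -- The coefficient of index k integrates against the character of index -k.
  rw [h2, ← (Equiv.neg (Fin n → ℤ)).hasSum_iff] at h1
  refine h1.congr_fun fun k => ?_
  simp only [Function.comp_apply, Equiv.neg_apply]
  congr 2
  rw [← hπ.map_eq, integral_map hπ.measurable.aemeasurable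
    (by rw [hπ.map_eq]; exact ((continuous_character _).aestronglyMeasurable.mul hP.1)),
    mFourierCoeff]
  refine integral_congr_ae ?_
  filter_upwards [hf.coeFn_toLp] with t ht
  rw [ht, neg_neg, mFourier_eq_character]
  rfl

end Torus

/-! ### Fourier coefficients of compactly supported functions -/

/-- The autocorrelation `∫ conj h(t) h(t + x) dt`. -/
noncomputable def autocorr {n : ℕ} (h : Rn n → ℂ) (x : Rn n) : ℂ :=
  ∫ t, starRingEnd ℂ (h t) * h (t + x)

/-- Two points of a ball of radius `R` differ by a vector of norm at most `2 * R`. -/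
theorem autocorr_eq_zero {n : ℕ} {h : Rn n → ℂ} {R : ℝ} (hR : ∀ t, R < ‖t‖ → h t = 0) {x : Rn n}
    (hx : 2 * R < ‖x‖) : autocorr h x = 0 := by
  rw [autocorr, ← integral_zero (Rn n) ℂ]
  congr 1
  funext t
  by_cases ht : R < ‖t‖
  · rw [hR t ht, map_zero, zero_mul]
  · rw [hR (t + x), mul_zero]
    have h1 : ‖x‖ ≤ ‖t + x‖ + ‖t‖ := by
      have := norm_sub_le (t + x) t
      rwa [add_sub_cancel_left] at this
    linarith

theorem summable_autocorr {n : ℕ} {h : Rn n → ℂ} {R : ℝ} (hR : ∀ t, R < ‖t‖ → h t = 0) :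
    Summable fun k : Fin n → ℤ => autocorr h (intVec k) := by
  refine summable_of_hasFiniteSupport ((finite_norm_intVec_le n (2 * R)).subset fun k hk => ?_)
  by_contra hlt
  exact hk (autocorr_eq_zero hR (not_le.1 hlt))

theorem character_add_intVec {n : ℕ} (k l : Fin n → ℤ) (t : Rn n) :
    character (intVec k) (t + intVec l) = character (intVec k) t := by
  rw [character, character, inner_add_right, AddChar.map_add_eq_mul, Circle.coe_mul]
  have h : (Real.fourierChar (inner ℝ (intVec k) (intVec l)) : ℂ) = 1 := by
    have h2 : (inner ℝ (intVec k) (intVec l) : ℝ) = ((∑ i, l i * k i : ℤ) : ℝ) := by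
      simp [PiLp.inner_apply]
    rw [h2, Real.fourierChar_apply, Complex.exp_eq_one_iff]
    exact ⟨∑ i, l i * k i, by push_cast; ring⟩
  rw [h, mul_one]

/-- Parseval's identity for the periodization of a compactly supported `L²` function. -/
theorem hasSum_sq_fourier_lattice {n : ℕ} {h : Rn n → ℂ} (hh : MemLp h 2 volume) {R : ℝ}
    (hR : ∀ t, R < ‖t‖ → h t = 0) :
    HasSum (fun k : Fin n → ℤ => ((‖∫ t, character (intVec k) t * h t‖ ^ 2 : ℝ) : ℂ))
      (∑' k : Fin n → ℤ, autocorr h (intVec k)) := by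
  obtain ⟨R', hR'⟩ := cube_subset_closedBall n
  set P : Rn n → ℂ := fun t => ∑' k : Fin n → ℤ, h (t + intVec k) with hP
  have hPper : ∀ k t, P (t + intVec k) = P t := by
    intro k t
    rw [hP]
    simp only
    rw [← (Equiv.addLeft k).tsum_eq (fun l => h (t + intVec l))]
    refine tsum_congr fun l => ?_
    rw [Equiv.coe_addLeft, intVec_add, add_assoc]
  have hshift : ∀ x : Rn n, MemLp (fun t => h (t + x)) 2 volume := fun x =>
    hh.comp_measurePreserving (measurePreserving_add_right volume x)
  have hint : Integrable h volume := by
    have h1 : h = Set.indicator (Metric.closedBall 0 R) h := by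
      funext t
      by_cases ht : t ∈ Metric.closedBall (0 : Rn n) R
      · rw [Set.indicator_of_mem ht]
      · rw [Set.indicator_of_notMem ht, hR]
        simpa using ht
    rw [h1, integrable_indicator_iff measurableSet_closedBall]
    have : IsFiniteMeasure (volume.restrict (Metric.closedBall (0 : Rn n) R)) :=
      ⟨by rw [Measure.restrict_apply_univ]; exact measure_closedBall_lt_top⟩
    exact (hh.restrict _).integrable (by norm_num)
  -- on bounded sets the periodization is a finite sum
  have hfin : ∀ (C : ℝ) (t : Rn n), ‖t‖ ≤ C →
      P t = ∑ k ∈ (finite_norm_intVec_le n (R + C)).toFinset, h (t + intVec k) := by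
    intro C t ht
    refine tsum_eq_sum fun k hk => hR _ ?_
    rw [Set.Finite.mem_toFinset, Set.mem_ofPred_eq, not_le] at hk
    have h1 : ‖intVec k‖ ≤ ‖t + intVec k‖ + ‖t‖ := by
      have := norm_sub_le (t + intVec k) t
      rwa [add_sub_cancel_left] at this
    linarith
  have hPmem : MemLp P 2 (volume.restrict (cube n)) := by
    have h1 : MemLp (fun t => ∑ k ∈ (finite_norm_intVec_le n (R + R')).toFinset, h (t + intVec k))
        2 (volume.restrict (cube n)) :=
      (memLp_finsetSum _ fun k _ => hshift (intVec k)).restrict _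
    refine (memLp_congr_ae ?_).1 h1
    filter_upwards [ae_restrict_mem (measurableSet_cube n)] with t ht
    exact (hfin R' t (hR' t ht)).symm
  have hterm : ∀ x : Rn n, Integrable (fun t => starRingEnd ℂ (h t) * h (t + x)) volume := fun x =>
    MemLp.integrable_mul hh.star (hshift x)
  -- Where `h t` is nonzero, only finitely many shifts matter, the same for all such `t`; this lets
  -- sum and integral be exchanged.
  have hprod : ∀ t, starRingEnd ℂ (h t) * P t
      = ∑ k ∈ (finite_norm_intVec_le n (R + R)).toFinset,
        starRingEnd ℂ (h t) * h (t + intVec k) := by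
    intro t
    by_cases ht : R < ‖t‖
    · simp [hR t ht]
    · rw [hfin R t (not_lt.1 ht), Finset.mul_sum]
  have h1 := hasSum_sq_fourier_cube hPmem
  have h2 : ∀ k : Fin n → ℤ, ∫ t in cube n, character (intVec k) t * P t
      = ∫ t, character (intVec k) t * h t := by
    intro k
    have hi : Integrable (fun t => character (intVec k) t * h t) volume :=
      (hint.bdd_mul (c := 1) (continuous_character _).aestronglyMeasurable
        (Eventually.of_forall fun t => (norm_character _ t).le))
    rw [← integral_cube_tsum hi]
    congr 1
    funext t
    simp only [character_add_intVec]
    rw [tsum_mul_left]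
  -- Unfolding: one factor of |P|² is expanded as a lattice sum, while the other is periodic, so the
  -- integral over the cube becomes one over the whole space.
  have h3 : ((∫ t in cube n, ‖P t‖ ^ 2 : ℝ) : ℂ) = ∑' k : Fin n → ℤ, autocorr h (intVec k) := by
    have hi : Integrable (fun t => starRingEnd ℂ (h t) * P t) volume := by
      simp only [hprod]
      exact integrable_finsetSum _ fun k _ => hterm _
    calc ((∫ t in cube n, ‖P t‖ ^ 2 : ℝ) : ℂ)
        = ∫ t in cube n, ∑' k : Fin n → ℤ,
            starRingEnd ℂ (h (t + intVec k)) * P (t + intVec k) := by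
          rw [← integral_complex_ofReal]
          congr 1
          funext t
          simp only [hPper]
          rw [tsum_mul_right, ← Complex.conj_tsum, ← Complex.normSq_eq_conj_mul_self,
            Complex.normSq_eq_norm_sq]
      _ = ∫ t, starRingEnd ℂ (h t) * P t := integral_cube_tsum hi
      _ = ∑ k ∈ (finite_norm_intVec_le n (R + R)).toFinset, autocorr h (intVec k) := by
          simp only [hprod]
          exact integral_finsetSum _ fun k _ => hterm _
      _ = ∑' k : Fin n → ℤ, autocorr h (intVec k) := by
          refine (tsum_eq_sum fun k hk => autocorr_eq_zero hR ?_).symm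
          rw [Set.Finite.mem_toFinset, Set.mem_ofPred_eq, not_le] at hk
          linarith
  rw [← h3]
  simp only [h2] at h1
  exact (Complex.hasSum_ofReal).2 h1

/-! ### The unitary extension identity for one dilation step -/

theorem integral_eq_absDet_mul_integral_comp {n : ℕ} (T : Rn n ≃ₗ[ℝ] Rn n) (u : Rn n → ℂ) :
    ∫ t, u t = (absDet T : ℂ) * ∫ t, u (T t) := by
  have h3 := (measurableEmbedding_linearEquiv T).integral_map (μ := volume) u
  rw [map_volume_linearEquiv, integral_smul_measure] at h3
  rw [← h3, ENNReal.toReal_ofReal (inv_nonneg.2 (absDet_pos T).le), Complex.real_smul,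
    ← mul_assoc, ← Complex.ofReal_mul, mul_inv_cancel₀ (absDet_pos T).ne']
  simp

theorem ae_add_right {n : ℕ} {p : Rn n → Prop} (h : ∀ᵐ t, p t) (y : Rn n) : ∀ᵐ t, p (t + y) :=
  (measurePreserving_add_right volume y).quasiMeasurePreserving.ae h

theorem memLp_conj_mul_continuous {n : ℕ} {g F : Rn n → ℂ} (hg : MemLp g 2 volume)
    (hF : Continuous F) (hFc : HasCompactSupport F) :
    MemLp (fun t => starRingEnd ℂ (g t) * F t) 2 volume := by
  obtain ⟨C, hC⟩ := hFc.exists_bound_of_continuous hF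
  refine (hg.const_mul (C : ℂ)).of_le
    ((Complex.continuous_conj.comp_aestronglyMeasurable hg.1).mul hF.aestronglyMeasurable)
    (Eventually.of_forall fun t => ?_)
  rw [norm_mul, norm_mul, RCLike.norm_conj, mul_comm]
  have h1 : ‖(C : ℂ)‖ = |C| := Complex.norm_real C
  rw [h1]
  gcongr
  exact (hC t).trans (le_abs_self C)

theorem exists_norm_bound_support {n : ℕ} {F : Rn n → ℂ} (hFc : HasCompactSupport F) :
    ∃ R : ℝ, 0 ≤ R ∧ ∀ t, R < ‖t‖ → F t = 0 := by
  obtain ⟨R, hR⟩ := hFc.isCompact.isBounded.subset_closedBall (0 : Rn n)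
  refine ⟨max R 0, le_max_right _ _, fun t ht => ?_⟩
  by_contra h
  have := hR (subset_tsupport F h)
  rw [mem_closedBall_zero_iff] at this
  exact absurd (this.trans (le_max_left R 0)) (not_le.2 ht)

theorem continuous_dilateFun {n : ℕ} (T : Rn n ≃ₗ[ℝ] Rn n) {F : Rn n → ℂ} (hF : Continuous F) :
    Continuous (dilateFun T F) :=
  continuous_const.mul (hF.comp T.toContinuousLinearEquiv.continuous)

theorem hasCompactSupport_dilateFun {n : ℕ} (T : Rn n ≃ₗ[ℝ] Rn n) {F : Rn n → ℂ}
    (hF : HasCompactSupport F) : HasCompactSupport (dilateFun T F) :=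
  (hF.comp_homeomorph T.toContinuousLinearEquiv.toHomeomorph).mul_left

/-- The sum over the lattice of the autocorrelations of `conj g · F`. -/
noncomputable def latticeEnergy {n : ℕ} (g F : Rn n → ℂ) : ℂ :=
  ∑' k : Fin n → ℤ, autocorr (fun t => starRingEnd ℂ (g t) * F t) (intVec k)

theorem hasSum_latticeEnergy {n : ℕ} {g F : Rn n → ℂ} (hg : MemLp g 2 volume)
    (hF : Continuous F) (hFc : HasCompactSupport F) :
    HasSum (fun k : Fin n → ℤ =>
      ((‖∫ t, character (intVec k) t * (starRingEnd ℂ (g t) * F t)‖ ^ 2 : ℝ) : ℂ))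
      (latticeEnergy g F) := by
  obtain ⟨R, -, hR⟩ := exists_norm_bound_support hFc
  exact hasSum_sq_fourier_lattice (memLp_conj_mul_continuous hg hF hFc)
    fun t ht => by rw [hR t ht, mul_zero]

/-- The sum of the autocorrelations, at one lattice point, of the functions `conj (G i) · F`, where
`G i (T t) = m i t * g t`. -/
theorem sum_autocorr_eq {n : ℕ} {ι : Type*} [Fintype ι] (T : Rn n ≃ₗ[ℝ] Rn n)
    {g F : Rn n → ℂ} {G m : ι → Rn n → ℂ} (hGL : ∀ i, MemLp (G i) 2 volume) (hF : Continuous F)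
    (hFc : HasCompactSupport F) (hG : ∀ i, ∀ᵐ t, G i (T t) = m i t * g t) (y : Rn n) :
    ∑ i, autocorr (fun t => starRingEnd ℂ (G i t) * F t) (T y) =
      (absDet T : ℂ) * ∫ t, (∑ i, m i t * starRingEnd ℂ (m i (t + y))) *
        (g t * starRingEnd ℂ (g (t + y)) * (starRingEnd ℂ (F (T t)) * F (T (t + y)))) := by
  have hL := fun i => memLp_conj_mul_continuous (hGL i) hF hFc
  simp only [autocorr]
  rw [← integral_finsetSum, integral_eq_absDet_mul_integral_comp T]
  · congr 1
    refine integral_congr_ae ?_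
    have h1 : ∀ᵐ t, ∀ i, G i (T t) = m i t * g t := ae_all_iff.2 hG
    filter_upwards [h1, ae_add_right h1 y] with t ht hty
    rw [Finset.sum_mul]
    refine Finset.sum_congr rfl fun i _ => ?_
    rw [← map_add, ht i, hty i]
    simp only [map_mul, Complex.conj_conj]
    ring
  · intro i _
    exact MemLp.integrable_mul (hL i).star
      ((hL i).comp_measurePreserving (measurePreserving_add_right volume (T y)))

/-- **The unitary extension identity**: one step of the dilation splits the lattice energy. -/
theorem sum_latticeEnergy_eq {n : ℕ} {ι : Type*} [Fintype ι] (T : Rn n ≃ₗ[ℝ] Rn n)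
    (hTZ : ∀ k : Fin n → ℤ, T (intVec k) ∈ intLattice n)
    {g F : Rn n → ℂ} {G m : ι → Rn n → ℂ} (hGL : ∀ i, MemLp (G i) 2 volume)
    (hF : Continuous F) (hFc : HasCompactSupport F)
    (hG : ∀ i, ∀ᵐ t, G i (T t) = m i t * g t)
    (hm : ∀ i (k : Fin n → ℤ) t, m i (t + intVec k) = m i t)
    (hdiag : ∀ᵐ t, g t ≠ 0 → ∑ i, m i t * starRingEnd ℂ (m i t) = 1)
    (hcross : ∀ y, T y ∈ intLattice n → y ∉ intLattice n →
      ∀ᵐ t, g t ≠ 0 → g (t + y) ≠ 0 → ∑ i, m i t * starRingEnd ℂ (m i (t + y)) = 0) :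
    ∑ i, latticeEnergy (G i) F = latticeEnergy g (dilateFun T F) := by
  obtain ⟨R, -, hR⟩ := exists_norm_bound_support hFc
  choose τ hτ using hTZ
  have hτinj : Function.Injective τ := by
    intro k l hkl
    have h1 : T (intVec k) = T (intVec l) := by rw [← hτ, ← hτ, hkl]
    exact intVec_injective (T.injective h1)
  simp only [latticeEnergy]
  rw [← Summable.tsum_finsetSum fun i _ => summable_autocorr (R := R)
    (fun t ht => by rw [hR t ht, mul_zero])]
  -- Only lattice points of the form T l contribute, so the sum is reindexed by l along `τ`, the
  -- action of `T` on integer coordinates.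
  rw [← hτinj.tsum_eq]
  · refine tsum_congr fun k => ?_
    rw [hτ, sum_autocorr_eq T hGL hF hFc hG, autocorr, ← integral_const_mul]
    refine integral_congr_ae ?_
    filter_upwards [hdiag] with t ht
    simp only [hm, dilateFun, map_mul, Complex.conj_conj, Complex.conj_ofReal]
    -- The Jacobian of t ↦ T t supplies exactly the normalizing factors of the two copies of
    -- `dilateFun T F`.
    have hd : (absDet T : ℂ) = (Real.sqrt (absDet T) : ℂ) * (Real.sqrt (absDet T) : ℂ) := by
      rw [← Complex.ofReal_mul, Real.mul_self_sqrt (absDet_pos T).le]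
    by_cases hgt : g t = 0
    · simp [hgt]
    · rw [ht hgt, hd]
      ring
  · intro k hk
    by_contra hnot
    refine hk ?_
    -- A point outside T(ℤⁿ) has a nonlattice preimage, and the cross identity there annihilates the
    -- integrand wherever `g` does not already do so.
    have hy : T.symm (intVec k) ∉ intLattice n := by
      rintro ⟨l, hl⟩
      refine hnot ⟨l, intVec_injective ?_⟩
      rw [hτ, hl, LinearEquiv.apply_symm_apply]
    have h1 := hcross (T.symm (intVec k)) (by
      rw [LinearEquiv.apply_symm_apply]; exact ⟨k, rfl⟩) hy
    have h2 := sum_autocorr_eq T hGL hF hFc hG (T.symm (intVec k))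
    rw [LinearEquiv.apply_symm_apply] at h2
    simp only
    rw [h2, integral_eq_zero_of_ae, mul_zero]
    filter_upwards [h1] with t ht
    by_cases hgt : g t = 0
    · simp [hgt]
    by_cases hgy : g (t + T.symm (intVec k)) = 0
    · simp [hgy]
    rw [ht hgt hgy, zero_mul]
    rfl

/-! ### The null set and the coset representatives -/

theorem bracket_add_intVec {n : ℕ} (g : Rn n → ℂ) (t : Rn n) (k : Fin n → ℤ) :
    bracket g (t + intVec k) = bracket g t := by
  rw [bracket, bracket, ← (Equiv.addLeft k).tsum_eq (fun l => ‖g (t + intVec l)‖ₑ ^ 2)]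
  refine tsum_congr fun l => ?_
  rw [Equiv.coe_addLeft, intVec_add, add_assoc]

theorem notMem_nullSet_of_ne_zero {n : ℕ} {g : Rn n → ℂ} {t : Rn n} (h : g t ≠ 0) :
    t ∉ nullSet g := by
  intro h0
  have h1 := ENNReal.tsum_eq_zero.1 h0 0
  rw [intVec_zero, add_zero, pow_eq_zero_iff two_ne_zero, enorm_eq_zero] at h1
  exact h h1

/-- The cross identities for coset representatives extend to all nonlattice points of
`B⁻¹(ℤⁿ)`. -/
theorem cross_of_isCosetRepresentatives {n : ℕ} {ι : Type*} [Fintype ι] {B : Rn n →ₗ[ℝ] Rn n}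
    {Γ : Set (Rn n)} (hΓ : IsCosetRepresentatives B Γ) {g : Rn n → ℂ} {m : ι → Rn n → ℂ}
    (hm : ∀ i (k : Fin n → ℤ) t, m i (t + intVec k) = m i t)
    (hcross : ∀ᵐ t, t ∉ nullSet g → ∀ p ∈ Γ, p ≠ 0 → t + p ∉ nullSet g →
      ∑ i, m i t * starRingEnd ℂ (m i (t + p)) = 0) (y : Rn n) (hy : B y ∈ intLattice n)
    (hy' : y ∉ intLattice n) :
    ∀ᵐ t, g t ≠ 0 → g (t + y) ≠ 0 → ∑ i, m i t * starRingEnd ℂ (m i (t + y)) = 0 := by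
  obtain ⟨p, ⟨hp, k, hk⟩, -⟩ := hΓ.2.2 y hy
  have hyp : y = p + intVec k := by rw [hk]; abel
  have hp0 : p ≠ 0 := by
    rintro rfl
    exact hy' ⟨k, by rw [hyp, zero_add]⟩
  filter_upwards [hcross] with t ht hgt hgy
  have h1 := notMem_nullSet_of_ne_zero hgy
  have h2 : t + p ∉ nullSet g := by
    rwa [nullSet, Set.mem_ofPred_eq, hyp, ← add_assoc, bracket_add_intVec] at h1
  have h3 := ht (notMem_nullSet_of_ne_zero hgt) p hp hp0 h2
  rw [← h3, hyp]
  simp only [← add_assoc, hm]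

/-! ### Approximate continuity and the limit at small scales -/

theorem volume_preimage_linearEquiv {n : ℕ} (T : Rn n ≃ₗ[ℝ] Rn n) (E : Set (Rn n)) :
    volume (T ⁻¹' E) = ENNReal.ofReal (absDet T)⁻¹ * volume E := by
  rw [← (measurableEmbedding_linearEquiv T).map_apply, map_volume_linearEquiv]
  rfl

theorem pow_apply_symm_pow {n : ℕ} (T : Rn n ≃ₗ[ℝ] Rn n) (j : ℕ) (t : Rn n) :
    (T ^ j) ((T.symm ^ j) t) = t := by
  have h : T ^ j * T.symm ^ j = 1 := by
    change T ^ j * T⁻¹ ^ j = 1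
    rw [inv_pow, mul_inv_cancel]
  exact congrArg (fun S : Rn n ≃ₗ[ℝ] Rn n => S t) h

theorem symm_pow_apply_pow {n : ℕ} (T : Rn n ≃ₗ[ℝ] Rn n) (j : ℕ) (t : Rn n) :
    (T.symm ^ j) ((T ^ j) t) = t := by
  have h : T.symm ^ j * T ^ j = 1 := by
    change T⁻¹ ^ j * T ^ j = 1
    rw [inv_pow, inv_mul_cancel]
  exact congrArg (fun S : Rn n ≃ₗ[ℝ] Rn n => S t) h

theorem coe_linearEquiv_pow {n : ℕ} (T : Rn n ≃ₗ[ℝ] Rn n) (j : ℕ) (t : Rn n) :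
    ((T : Rn n →ₗ[ℝ] Rn n) ^ j) t = (T ^ j) t := by
  induction j generalizing t with
  | zero => rfl
  | succ j ih => rw [pow_succ, pow_succ]; exact ih _

/-- Approximate continuity along a dilation gives convergence in measure on balls. -/
theorem tendsto_volume_of_isApproxContinuousAt {n : ℕ} (T : Rn n ≃ₗ[ℝ] Rn n)
    (hT : Tendsto (fun j : ℕ => toCLM T.symm ^ j) atTop (𝓝 0)) {a : Rn n → ℝ}
    (ha : IsApproxContinuousAt (T : Rn n →ₗ[ℝ] Rn n) a 0) {r ε : ℝ} (hr : 0 < r) (hε : 0 < ε) :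
    Tendsto (fun j : ℕ => volume {t : Rn n | t ∈ Metric.ball (0 : Rn n) r ∧ ε ≤ |a ((T.symm ^ j) t) - a 0|})
      atTop (𝓝 0) := by
  obtain ⟨S, hS, -, hdens, hlim⟩ := ha
  set P : ℕ → Set (Rn n) := fun j => shrunkBall (T : Rn n →ₗ[ℝ] Rn n) j r 0 with hP
  have hPpre : ∀ j, P j = (T ^ j) ⁻¹' Metric.ball 0 r := by
    intro j
    ext y
    simp only [hP, shrunkBall, sub_zero, Set.mem_ofPred_eq, Set.mem_preimage, coe_linearEquiv_pow]
  have hpre : ∀ j, ⇑(T.symm ^ j) ⁻¹' P j = Metric.ball 0 r := by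
    intro j
    rw [hPpre]
    ext t
    rw [Set.mem_preimage, Set.mem_preimage, pow_apply_symm_pow]
  have hP0 : ∀ j, volume (P j) ≠ 0 := by
    intro j
    rw [hPpre, volume_preimage_linearEquiv]
    refine mul_ne_zero ?_ (Metric.measure_ball_pos volume _ hr).ne'
    simpa using absDet_pos (T ^ j)
  have hPtop : ∀ j, volume (P j) ≠ ∞ := by
    intro j
    rw [hPpre, volume_preimage_linearEquiv]
    exact ENNReal.mul_ne_top ENNReal.ofReal_ne_top measure_ball_lt_top.ne
  -- A linear map scales all volumes by one factor, so pulling `P j \ S` back into the ball gives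
  -- the volume of the ball times the relative volume of the part outside `S`.
  have hdiff : Tendsto (fun j => volume (Metric.ball (0 : Rn n) r) *
      (volume (P j \ S) / volume (P j))) atTop (𝓝 0) := by
    have h1 : ∀ j, volume (P j \ S) / volume (P j) = 1 - volume (S ∩ P j) / volume (P j) := by
      intro j
      have h2 : volume (P j \ S) = volume (P j) - volume (S ∩ P j) := by
        rw [← Set.sdiff_inter_self_eq_sdiff,
          measure_sdiff Set.inter_subset_right
            (hS.inter (by
              rw [hPpre]
              exact ((measurableEmbedding_linearEquiv (T ^ j)).measurable
                measurableSet_ball).nullMeasurableSet))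
            (measure_ne_top_of_subset Set.inter_subset_right (hPtop j))]
      rw [h2, ENNReal.sub_div (fun _ _ => hP0 j), ENNReal.div_self (hP0 j) (hPtop j)]
    simp only [h1]
    have h3 := ENNReal.Tendsto.sub (tendsto_const_nhds (x := (1 : ℝ≥0∞))) (hdens r hr)
      (Or.inl ENNReal.one_ne_top)
    have h4 := ENNReal.Tendsto.const_mul (a := volume (Metric.ball (0 : Rn n) r)) h3
      (Or.inr measure_ball_lt_top.ne)
    simpa using h4
  refine tendsto_of_tendsto_of_tendsto_of_le_of_le' tendsto_const_nhds hdiff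
    (Eventually.of_forall fun _ => zero_le) ?_
  rw [Metric.tendsto_nhdsWithin_nhds] at hlim
  obtain ⟨δ, hδ, hclose⟩ := hlim ε hε
  -- From such a j on, the image of the ball lies within `δ` of the origin, so `a` can be far from
  -- `a 0` only off `S`.
  have hnorm : ∀ᶠ j : ℕ in atTop, ‖toCLM T.symm ^ j‖ * r < δ := by
    have h1 := (tendsto_norm_zero.comp hT).mul_const r
    rw [zero_mul] at h1
    exact h1.eventually_lt_const hδ
  filter_upwards [hnorm] with j hj
  have hsub : {t : Rn n | t ∈ Metric.ball (0 : Rn n) r ∧ ε ≤ |a ((T.symm ^ j) t) - a 0|} ⊆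
      ⇑(T.symm ^ j) ⁻¹' (P j \ S) := by
    rintro t ⟨ht, hat⟩
    refine ⟨by rw [← Set.mem_preimage, hpre]; exact ht, fun hS' => ?_⟩
    have h1 : dist ((T.symm ^ j) t) 0 < δ := by
      rw [dist_zero_right, ← toCLM_pow_apply]
      refine lt_of_le_of_lt ((toCLM T.symm ^ j).le_opNorm t) (lt_of_le_of_lt ?_ hj)
      gcongr
      exact (mem_ball_zero_iff.1 ht).le
    have h2 := hclose hS' h1
    rw [Real.dist_eq] at h2
    linarith
  refine (measure_mono hsub).trans (le_of_eq ?_)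
  rw [← hpre j, volume_preimage_linearEquiv, volume_preimage_linearEquiv, mul_assoc,
    ENNReal.mul_div_cancel (hP0 j) (hPtop j)]

/-- If `a` decreases along the orbits of `T` and is approximately continuous at the origin, then it
tends to `a 0` along almost every backward orbit, and stays below that value. -/
theorem ae_tendsto_symm_pow {n : ℕ} (T : Rn n ≃ₗ[ℝ] Rn n)
    (hT : Tendsto (fun j : ℕ => toCLM T.symm ^ j) atTop (𝓝 0)) {a : Rn n → ℝ}
    (ha : IsApproxContinuousAt (T : Rn n →ₗ[ℝ] Rn n) a 0) (hmono : ∀ᵐ t, a (T t) ≤ a t) :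
    ∀ᵐ t : Rn n, (∀ j : ℕ, a ((T.symm ^ j) t) ≤ a 0) ∧
      Tendsto (fun j : ℕ => a ((T.symm ^ j) t)) atTop (𝓝 (a 0)) := by
  have h1 : ∀ᵐ t : Rn n, ∀ j : ℕ, a ((T.symm ^ j) t) ≤ a ((T.symm ^ (j + 1)) t) := by
    rw [ae_all_iff]
    intro j
    filter_upwards [(quasiMeasurePreserving_linearEquiv (T.symm ^ (j + 1))).ae hmono] with t ht
    have h : T ((T.symm ^ (j + 1)) t) = (T.symm ^ j) t := by
      rw [pow_succ']
      exact T.apply_symm_apply _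
    rwa [h] at ht
  have h2 : ∀ᵐ t : Rn n, ∀ r q J : ℕ, ¬ ∀ j, J ≤ j →
      t ∈ Metric.ball (0 : Rn n) (r + 1) ∧ 1 / (q + 1 : ℝ) ≤ |a ((T.symm ^ j) t) - a 0| := by
    simp only [ae_all_iff]
    intro r q J
    rw [ae_iff]
    simp only [not_not]
    have h3 := tendsto_volume_of_isApproxContinuousAt T hT ha (r := r + 1) (ε := 1 / (q + 1))
      (by positivity) (by positivity)
    -- Points that stay bad from `J` on lie in the bad set of every single j ≥ J, and those volumes
    -- tend to 0.
    refine le_antisymm (ge_of_tendsto h3 ?_) zero_le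
    filter_upwards [eventually_ge_atTop J] with j hj
    exact measure_mono fun t ht => ht j hj
  filter_upwards [h1, h2] with t ht1 ht2
  have hmon : Monotone fun j : ℕ => a ((T.symm ^ j) t) := monotone_nat_of_le_succ ht1
  have hfreq : ∀ ε : ℝ, 0 < ε → ∀ J : ℕ, ∃ j, J ≤ j ∧ |a ((T.symm ^ j) t) - a 0| < ε := by
    intro ε hε J
    obtain ⟨q, hq⟩ := exists_nat_one_div_lt hε
    obtain ⟨r, hr⟩ := exists_nat_gt ‖t‖
    have h4 := ht2 r q J
    push Not at h4
    obtain ⟨j, hj, h5⟩ := h4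
    refine ⟨j, hj, (h5 ?_).trans hq⟩
    rw [mem_ball_zero_iff]
    linarith
  -- A value above `a 0` would persist by monotonicity and contradict the recurrent closeness
  -- `hfreq`.
  have hle : ∀ j : ℕ, a ((T.symm ^ j) t) ≤ a 0 := by
    intro j
    by_contra hlt
    push Not at hlt
    obtain ⟨i, hi, hi'⟩ := hfreq _ (sub_pos.2 hlt) j
    have h5 : a ((T.symm ^ j) t) ≤ a ((T.symm ^ i) t) := hmon hi
    have h6 := (abs_lt.1 hi').2
    linarith
  refine ⟨hle, Metric.tendsto_atTop.2 fun ε hε => ?_⟩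
  obtain ⟨J, -, hJ⟩ := hfreq ε hε 0
  refine ⟨J, fun j hj => ?_⟩
  have h5 : a ((T.symm ^ J) t) ≤ a ((T.symm ^ j) t) := hmon hj
  have h6 := (abs_lt.1 hJ).1
  rw [Real.dist_eq, abs_lt]
  constructor <;> linarith [hle j]

/-- The lattice energies of the dilates of `F` converge to the energy of `F` at small scales. -/
theorem tendsto_latticeEnergy_dilateFun {n : ℕ} (T : Rn n ≃ₗ[ℝ] Rn n)
    (hT : Tendsto (fun j : ℕ => toCLM T.symm ^ j) atTop (𝓝 0)) {g F : Rn n → ℂ}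
    (hg : AEStronglyMeasurable g volume)
    (hlim : ∀ᵐ t : Rn n, (∀ j : ℕ, ‖g ((T.symm ^ j) t)‖ ≤ 1) ∧
      Tendsto (fun j : ℕ => ‖g ((T.symm ^ j) t)‖) atTop (𝓝 1))
    (hF : Continuous F) (hFc : HasCompactSupport F) :
    Tendsto (fun j : ℕ => latticeEnergy g (dilateFun (T ^ j) F)) atTop
      (𝓝 (∫ t, ((‖F t‖ ^ 2 : ℝ) : ℂ))) := by
  obtain ⟨R, hR0, hR⟩ := exists_norm_bound_support hFc
  have h1 : ∀ᶠ j : ℕ in atTop, latticeEnergy g (dilateFun (T ^ j) F)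
      = ∫ t, ((‖g ((T.symm ^ j) t)‖ ^ 2 * ‖F t‖ ^ 2 : ℝ) : ℂ) := by
    -- The dilate is supported in a ball of diameter less than 1, the least norm of a nonzero
    -- lattice vector, so only the term at 0 remains.
    have hnorm : ∀ᶠ j : ℕ in atTop, ‖toCLM T.symm ^ j‖ * (2 * R) < 1 := by
      have h1 := (tendsto_norm_zero.comp hT).mul_const (2 * R)
      rw [zero_mul] at h1
      exact h1.eventually_lt_const one_pos
    filter_upwards [hnorm] with j hj
    have hsupp : ∀ t, ‖toCLM T.symm ^ j‖ * R < ‖t‖ →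
        starRingEnd ℂ (g t) * dilateFun (T ^ j) F t = 0 := by
      intro t ht
      have h2 : R < ‖(T ^ j) t‖ := by
        by_contra hle
        push Not at hle
        have h3 := (toCLM T.symm ^ j).le_opNorm ((T ^ j) t)
        rw [toCLM_pow_apply, symm_pow_apply_pow] at h3
        have h4 : ‖toCLM T.symm ^ j‖ * ‖(T ^ j) t‖ ≤ ‖toCLM T.symm ^ j‖ * R := by gcongr
        linarith
      rw [dilateFun, hR _ h2, mul_zero, mul_zero]
    rw [latticeEnergy, tsum_eq_single 0]
    · rw [intVec_zero, autocorr, integral_eq_absDet_mul_integral_comp (T ^ j)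
        (fun t => ((‖g ((T.symm ^ j) t)‖ ^ 2 * ‖F t‖ ^ 2 : ℝ) : ℂ)), ← integral_const_mul]
      congr 1
      funext t
      have hd : (absDet (T ^ j) : ℂ)
          = (Real.sqrt (absDet (T ^ j)) : ℂ) * (Real.sqrt (absDet (T ^ j)) : ℂ) := by
        rw [← Complex.ofReal_mul, Real.mul_self_sqrt (absDet_pos _).le]
      rw [symm_pow_apply_pow, add_zero, dilateFun, hd, ← Complex.normSq_eq_norm_sq,
        ← Complex.normSq_eq_norm_sq, Complex.ofReal_mul, Complex.normSq_eq_conj_mul_self,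
        Complex.normSq_eq_conj_mul_self]
      simp only [map_mul, Complex.conj_conj, Complex.conj_ofReal]
      ring
    · intro k hk
      refine autocorr_eq_zero hsupp ?_
      have := one_le_norm_intVec hk
      linarith
  refine Tendsto.congr' (h1.mono fun _ h => h.symm) ?_
  have hFsq : Integrable (fun t => ‖F t‖ ^ 2) volume := by
    refine (hF.norm.pow 2).integrable_of_hasCompactSupport ?_
    have h2 : HasCompactSupport ((fun z : ℂ => ‖z‖ ^ 2) ∘ F) := hFc.comp_left (by simp)
    exact h2
  refine tendsto_integral_of_dominated_convergence (fun t => ‖F t‖ ^ 2) ?_ hFsq ?_ ?_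
  · intro j
    have h2 := (hg.comp_quasiMeasurePreserving
      (quasiMeasurePreserving_linearEquiv (T.symm ^ j))).norm
    have h3 : AEStronglyMeasurable (fun t => ‖g ((T.symm ^ j) t)‖ ^ 2 * ‖F t‖ ^ 2) volume :=
      (h2.pow 2).mul (hF.norm.pow 2).aestronglyMeasurable
    exact Complex.continuous_ofReal.comp_aestronglyMeasurable h3
  · intro j
    filter_upwards [hlim] with t ht
    rw [Complex.norm_real, Real.norm_of_nonneg (by positivity)]
    have h3 : ‖g ((T.symm ^ j) t)‖ ^ 2 ≤ 1 := pow_le_one₀ (norm_nonneg _) (ht.1 j)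
    nlinarith [sq_nonneg ‖F t‖]
  · filter_upwards [hlim] with t ht
    have h3 := (ht.2.pow 2).mul_const (‖F t‖ ^ 2)
    rw [one_pow, one_mul] at h3
    exact (Complex.continuous_ofReal.tendsto _).comp h3

/-! ### Bessel families and density -/

/-- The family `e` is a Bessel family with bound `1`. -/
def IsBessel {ι H : Type*} [NormedAddCommGroup H] [InnerProductSpace ℂ H] (e : ι → H) : Prop :=
  ∀ f : H, Summable (fun i => ‖inner ℂ (e i) f‖ ^ 2) ∧ ∑' i, ‖inner ℂ (e i) f‖ ^ 2 ≤ ‖f‖ ^ 2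

section Bessel

variable {ι H : Type*} [NormedAddCommGroup H] [InnerProductSpace ℂ H] {e : ι → H}

/-- Finite partial sums are continuous in `f`, so their bound passes to the closure; continuity of
the full sum is not yet available. -/
theorem isBessel_of_dense {D : Set H} (hD : Dense D)
    (h : ∀ f ∈ D, ∃ c ≤ ‖f‖ ^ 2, HasSum (fun i => ‖inner ℂ (e i) f‖ ^ 2) c) : IsBessel e := by
  have h1 : ∀ (f : H) (s : Finset ι), ∑ i ∈ s, ‖inner ℂ (e i) f‖ ^ 2 ≤ ‖f‖ ^ 2 := by
    intro f s
    refine hD.induction (P := fun f => ∑ i ∈ s, ‖inner ℂ (e i) f‖ ^ 2 ≤ ‖f‖ ^ 2) ?_ ?_ f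
    · intro f hf
      obtain ⟨c, hc, hs⟩ := h f hf
      exact (sum_le_hasSum s (fun _ _ => by positivity) hs).trans hc
    · refine isClosed_le ?_ (by fun_prop)
      exact continuous_finsetSum _ fun i _ => (continuous_const.inner continuous_id).norm.pow 2
  intro f
  have h2 : Summable fun i => ‖inner ℂ (e i) f‖ ^ 2 :=
    summable_of_sum_le (fun _ => by positivity) (h1 f)
  exact ⟨h2, h2.tsum_le_of_sum_le (h1 f)⟩

theorem IsBessel.memℓp (he : IsBessel e) (f : H) : Memℓp (fun i => inner ℂ (e i) f) 2 := by
  refine memℓp_gen ?_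
  simpa using (he f).1

/-- The analysis operator `f ↦ (⟨e i, f⟩)ᵢ` of a Bessel family. -/
noncomputable def IsBessel.analysis (he : IsBessel e) : H →L[ℂ] lp (fun _ : ι => ℂ) 2 :=
  LinearMap.mkContinuous
    { toFun := fun f => ⟨fun i => inner ℂ (e i) f, he.memℓp f⟩
      map_add' := fun f g => by
        ext i
        exact inner_add_right _ _ _
      map_smul' := fun c f => by
        ext i
        exact inner_smul_right _ _ _ } 1 (fun f => by
      rw [one_mul]
      refine le_of_sq_le_sq ?_ (norm_nonneg _)
      have h := lp.norm_rpow_eq_tsum (p := 2) (by norm_num)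
        (⟨fun i => inner ℂ (e i) f, he.memℓp f⟩ : lp (fun _ : ι => ℂ) 2)
      have h2 := (he f).2
      simp at h
      simp
      rw [h]
      exact h2)

theorem IsBessel.norm_analysis_sq (he : IsBessel e) (f : H) :
    ‖he.analysis f‖ ^ 2 = ∑' i, ‖inner ℂ (e i) f‖ ^ 2 := by
  have h := lp.norm_rpow_eq_tsum (p := 2) (by norm_num) (he.analysis f)
  simp at h
  exact h

theorem IsBessel.norm_analysis_le (he : IsBessel e) (f : H) : ‖he.analysis f‖ ≤ ‖f‖ := by
  have h := (he f).2
  rw [← he.norm_analysis_sq] at h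
  exact le_of_sq_le_sq h (norm_nonneg _)

/-- The Parseval identity extends from a dense set. -/
theorem isParsevalFrame_of_dense {D : Set H} (hD : Dense D)
    (h : ∀ f ∈ D, HasSum (fun i => ‖inner ℂ (e i) f‖ ^ 2) (‖f‖ ^ 2)) : IsParsevalFrame e := by
  have he : IsBessel e := isBessel_of_dense hD fun f hf => ⟨_, le_rfl, h f hf⟩
  have h1 : ∀ f : H, ‖he.analysis f‖ ^ 2 = ‖f‖ ^ 2 := by
    intro f
    refine hD.induction (P := fun f => ‖he.analysis f‖ ^ 2 = ‖f‖ ^ 2) ?_ ?_ f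
    · intro f hf
      rw [he.norm_analysis_sq, (h f hf).tsum_eq]
    -- The Bessel bound makes the analysis operator continuous, so equality of norms is a closed
    -- condition.
    · exact isClosed_eq (he.analysis.continuous.norm.pow 2) (continuous_norm.pow 2)
  refine ⟨one_pos, one_pos, fun f => ⟨(he f).1, ?_, ?_⟩⟩ <;>
    rw [one_mul, ← he.norm_analysis_sq, h1]

/-- For isometries `U m`, the convergence `∑ᵢ |⟨e i, U m f⟩|² → 0` extends from a dense set. -/
theorem IsBessel.tendsto_of_dense (he : IsBessel e) (U : ℕ → H →ₗᵢ[ℂ] H) {D : Set H}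
    (hD : Dense D)
    (h : ∀ f ∈ D, Tendsto (fun m => ∑' i, ‖inner ℂ (e i) (U m f)‖ ^ 2) atTop (𝓝 0)) (f : H) :
    Tendsto (fun m => ∑' i, ‖inner ℂ (e i) (U m f)‖ ^ 2) atTop (𝓝 0) := by
  simp only [← he.norm_analysis_sq] at h ⊢
  have key : Tendsto (fun m => ‖he.analysis (U m f)‖) atTop (𝓝 0) := by
    rw [Metric.tendsto_atTop]
    intro ε hε
    -- The error from replacing `f` by `f'` is below ε/2 uniformly in `m`, because each `U m` is an
    -- isometry and analysis is a contraction.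
    obtain ⟨f', hf', hdist⟩ := Metric.dense_iff.1 hD f (ε / 2) (half_pos hε)
    have h1 : Tendsto (fun m => ‖he.analysis (U m f')‖) atTop (𝓝 0) := by
      have := (Real.continuous_sqrt.tendsto 0).comp (h f' hdist)
      rw [Real.sqrt_zero] at this
      refine this.congr fun m => Real.sqrt_sq (norm_nonneg _)
    obtain ⟨M, hM⟩ := Metric.tendsto_atTop.1 h1 (ε / 2) (half_pos hε)
    refine ⟨M, fun m hm => ?_⟩
    have h2 := hM m hm
    rw [Real.dist_eq, sub_zero, abs_of_nonneg (norm_nonneg _)] at h2 ⊢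
    have h3 : he.analysis (U m f) = he.analysis (U m f') + he.analysis (U m (f - f')) := by
      rw [← map_add, ← map_add, add_sub_cancel]
    have h4 : ‖he.analysis (U m (f - f'))‖ ≤ ‖f - f'‖ :=
      (he.norm_analysis_le _).trans ((U m).norm_map _).le
    rw [mem_ball_iff_norm] at hf'
    rw [norm_sub_rev] at h4
    rw [h3]
    linarith [norm_add_le (he.analysis (U m f')) (he.analysis (U m (f - f')))]
  have := key.pow 2
  simpa using this

end Bessel

/-- Square-integrable functions with a continuous, compactly supported representative. -/
def contCompact (n : ℕ) : Set (L2 n) :=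
  {f | ∃ F : Rn n → ℂ, Continuous F ∧ HasCompactSupport F ∧ F =ᵐ[volume] f}

theorem dense_contCompact (n : ℕ) : Dense (contCompact n) := by
  rw [Metric.dense_iff]
  intro f r hr
  obtain ⟨F, hFc, hF1, hF, hFL⟩ := (Lp.memLp f).exists_hasCompactSupport_eLpNorm_sub_le
    ENNReal.ofNat_ne_top (ε := ENNReal.ofReal (r / 2)) (by simpa using hr)
  refine ⟨hFL.toLp F, ?_, F, hF, hFc, hFL.coeFn_toLp.symm⟩
  rw [mem_ball_iff_norm']
  have h1 : ‖f - hFL.toLp F‖ = (eLpNorm (⇑f - F) 2 volume).toReal := by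
    rw [Lp.norm_def]
    congr 1
    refine eLpNorm_congr_ae ?_
    filter_upwards [Lp.coeFn_sub f (hFL.toLp F), hFL.coeFn_toLp] with t h1 h2
    rw [h1, Pi.sub_apply, Pi.sub_apply, h2]
  rw [h1]
  refine lt_of_le_of_lt (ENNReal.toReal_le_of_le_ofReal (half_pos hr).le hF1) (half_lt_self hr)

/-! ### Decay at large scales -/

theorem norm_sq_eq_lintegral {n : ℕ} (f : L2 n) :
    ENNReal.ofReal (‖f‖ ^ 2) = ∫⁻ t, ‖f t‖ₑ ^ 2 := by
  have h := eLpNorm_nnreal_pow_eq_lintegral (p := 2) (f := (f : Rn n → ℂ))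
    (μ := (volume : Measure (Rn n))) two_ne_zero
  have h1 : ENNReal.ofReal (‖f‖ ^ 2) = eLpNorm f 2 volume ^ 2 := by
    rw [Lp.norm_def, ENNReal.ofReal_pow ENNReal.toReal_nonneg, ENNReal.ofReal_toReal (Lp.eLpNorm_ne_top f)]
  rw [h1]
  simpa using h

/-- Coefficients of a function vanishing off `E` with respect to the integer translates. -/
theorem tsum_inner_translation_le {n : ℕ} (φ f : L2 n) {E : Set (Rn n)} (hE : MeasurableSet E)
    (hf : ∀ᵐ t, t ∉ E → f t = 0) :
    ∑' k : Fin n → ℤ, ENNReal.ofReal (‖inner ℂ (translation (intVec k) φ) f‖ ^ 2) ≤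
      ENNReal.ofReal (‖f‖ ^ 2) * ∫⁻ t in E, ∑' k : Fin n → ℤ, ‖φ (t + intVec k)‖ₑ ^ 2 := by
  have hφm : ∀ b : Rn n, AEStronglyMeasurable (fun t => φ (t + b)) volume := fun b =>
    (Lp.aestronglyMeasurable φ).comp_quasiMeasurePreserving
      (measurePreserving_add_right volume b).quasiMeasurePreserving
  rw [lintegral_tsum fun k => ((hφm (intVec k)).enorm.pow_const 2).restrict, ← ENNReal.tsum_mul_left,
    ← (Equiv.neg (Fin n → ℤ)).tsum_eq]
  refine ENNReal.tsum_le_tsum fun k => ?_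
  have h1 : translation (intVec (-k)) φ =ᵐ[volume] fun t => φ (t + intVec k) := by
    filter_upwards [coeFn_translation (intVec (-k)) φ] with t ht
    rw [ht, intVec_neg, sub_neg_eq_add]
  have h2 : ENNReal.ofReal ‖inner ℂ (translation (intVec (-k)) φ) f‖
      ≤ ∫⁻ t, ‖f t‖ₑ * E.indicator (fun t => ‖φ (t + intVec k)‖ₑ) t := by
    rw [L2.inner_def, ofReal_norm]
    refine (enorm_integral_le_lintegral_enorm _).trans (lintegral_mono_ae ?_)
    filter_upwards [h1, hf] with t ht hft
    rw [ht, RCLike.inner_apply, enorm_mul]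
    by_cases htE : t ∈ E
    · rw [Set.indicator_of_mem htE]
      refine le_of_eq ?_
      congr 1
      rw [← ofReal_norm, RCLike.norm_conj, ofReal_norm]
    · rw [hft htE]
      simp
  have h3 : AEMeasurable (E.indicator fun t => ‖φ (t + intVec k)‖ₑ) volume :=
    (hφm _).enorm.indicator hE
  -- Cauchy–Schwarz for each k, with the translate of `φ` cut off to `E`; the norm of `f` is then
  -- common to all terms.
  have h4 := ENNReal.lintegral_mul_le_Lp_mul_Lq volume Real.HolderConjugate.two_two
    (Lp.aestronglyMeasurable f).enorm h3
  have h5 : ∫⁻ t, E.indicator (fun t => ‖φ (t + intVec k)‖ₑ) t ^ (2 : ℝ)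
      = ∫⁻ t in E, ‖φ (t + intVec k)‖ₑ ^ 2 := by
    rw [← lintegral_indicator hE]
    congr 1
    funext t
    by_cases htE : t ∈ E <;> simp [htE]
  have h6 := h2.trans h4
  rw [h5] at h6
  simp only [ENNReal.rpow_two] at h6
  rw [← norm_sq_eq_lintegral] at h6
  have h7 := pow_le_pow_left' h6 2
  rw [mul_pow, ← ENNReal.rpow_natCast, ← ENNReal.rpow_natCast _ 2, ← ENNReal.rpow_natCast _ 2,
    ← ENNReal.rpow_mul, ← ENNReal.rpow_mul] at h7
  rw [Equiv.neg_apply, ENNReal.ofReal_pow (norm_nonneg _)]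
  simpa using h7

/-- Coefficients with respect to the integer translates of a single function tend to zero along
large scales. -/
theorem tendsto_tsum_inner_translation {n : ℕ} (hn : 0 < n) (A : Rn n ≃ₗ[ℝ] Rn n)
    (hA : Tendsto (fun j : ℕ => toCLM A.symm ^ j) atTop (𝓝 0)) (φ : L2 n) {f : L2 n}
    (hf : f ∈ contCompact n) :
    Tendsto (fun m : ℕ => ∑' k : Fin n → ℤ,
      ‖inner ℂ (translation (intVec k) φ) ((dilation A ^ m) f)‖ ^ 2) atTop (𝓝 0) := by
  obtain ⟨F, hF, hFc, hFf⟩ := hf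
  obtain ⟨R, hR0, hR⟩ := exists_norm_bound_support hFc
  set Φ : Rn n → ℝ≥0∞ := fun t => ∑' k : Fin n → ℤ, ‖φ (t + intVec k)‖ₑ ^ 2 with hΦ
  set ρ : ℕ → ℝ := fun m => ‖toCLM A.symm ^ m‖ * R with hρ
  have hρ0 : Tendsto ρ atTop (𝓝 0) := by
    have h1 := (tendsto_norm_zero.comp hA).mul_const R
    rwa [zero_mul] at h1
  -- The periodization of |φ|² has integral ‖φ‖² over the cube, so its integral over shrinking balls
  -- tends to 0 by absolute continuity.
  have hfin : ∫⁻ t in cube n, Φ t ≠ ∞ := by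
    rw [hΦ, ← lintegral_eq_lintegral_cube (f := fun t => ‖φ t‖ₑ ^ 2)
      ((Lp.aestronglyMeasurable φ).enorm.pow_const 2), ← norm_sq_eq_lintegral]
    exact ENNReal.ofReal_ne_top
  have hvol : Tendsto (fun m => volume.restrict (cube n) (Metric.closedBall (0 : Rn n) (ρ m))) atTop
      (𝓝 0) := by
    have h1 : Tendsto (fun m => volume (Metric.closedBall (0 : Rn n) (ρ m))) atTop (𝓝 0) := by
      have h2 : ∀ m, volume (Metric.closedBall (0 : Rn n) (ρ m))
          = ENNReal.ofReal (ρ m ^ n) * volume (Metric.ball (0 : Rn n) 1) := by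
        intro m
        rw [Measure.addHaar_closedBall _ _ (by positivity), finrank_euclideanSpace_fin]
      simp only [h2]
      have h3 := ENNReal.tendsto_ofReal (hρ0.pow n)
      -- Positive dimension matters: in dimension 0 the balls would keep volume 1.
      rw [zero_pow hn.ne', ENNReal.ofReal_zero] at h3
      have h4 := ENNReal.Tendsto.mul_const h3 (b := volume (Metric.ball (0 : Rn n) 1))
        (Or.inr measure_ball_lt_top.ne)
      rwa [zero_mul] at h4
    exact tendsto_of_tendsto_of_tendsto_of_le_of_le tendsto_const_nhds h1 (fun _ => zero_le)
      fun m => Measure.restrict_apply_le _ _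
  have hint := tendsto_setLIntegral_zero hfin hvol
  have hbound : ∀ᶠ m in atTop, ∑' k : Fin n → ℤ,
      ENNReal.ofReal (‖inner ℂ (translation (intVec k) φ) ((dilation A ^ m) f)‖ ^ 2)
      ≤ ENNReal.ofReal (‖f‖ ^ 2) *
        ∫⁻ t in Metric.closedBall (0 : Rn n) (ρ m), Φ t ∂(volume.restrict (cube n)) := by
    filter_upwards [hρ0.eventually_lt_const (show (0 : ℝ) < 1 / 2 by norm_num)] with m hm
    have hsub : Metric.closedBall (0 : Rn n) (ρ m) ⊆ cube n := fun t ht =>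
      ball_subset_cube (lt_of_le_of_lt (mem_closedBall_zero_iff.1 ht) hm)
    rw [Measure.restrict_restrict measurableSet_closedBall, Set.inter_eq_left.2 hsub,
      ← (dilation A ^ m).norm_map f]
    refine tsum_inner_translation_le φ _ measurableSet_closedBall ?_
    rw [dilation_pow]
    filter_upwards [coeFn_dilation (A ^ m) f,
      (quasiMeasurePreserving_linearEquiv (A ^ m)).ae_eq_comp hFf] with t h1 h2 ht
    have h2' : F ((A ^ m) t) = f ((A ^ m) t) := h2
    rw [h1, ← h2', hR, mul_zero]
    by_contra hle
    push Not at hle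
    refine ht (mem_closedBall_zero_iff.2 ?_)
    have h3 := (toCLM A.symm ^ m).le_opNorm ((A ^ m) t)
    rw [toCLM_pow_apply, symm_pow_apply_pow] at h3
    exact h3.trans (mul_le_mul_of_nonneg_left hle (norm_nonneg _))
  have hlim : Tendsto (fun m : ℕ => ∑' k : Fin n → ℤ,
      ENNReal.ofReal (‖inner ℂ (translation (intVec k) φ) ((dilation A ^ m) f)‖ ^ 2)) atTop
      (𝓝 0) := by
    have h1 := ENNReal.Tendsto.const_mul (a := ENNReal.ofReal (‖f‖ ^ 2)) hint
      (Or.inr ENNReal.ofReal_ne_top)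
    rw [mul_zero] at h1
    exact tendsto_of_tendsto_of_tendsto_of_le_of_le' tendsto_const_nhds h1
      (Eventually.of_forall fun _ => zero_le) hbound
  have h2 := (ENNReal.tendsto_toReal ENNReal.zero_ne_top).comp hlim
  refine h2.congr fun m => ?_
  rw [Function.comp_apply, ENNReal.tsum_toReal_eq fun _ => ENNReal.ofReal_ne_top]
  exact tsum_congr fun k => ENNReal.toReal_ofReal (by positivity)

/-! ### Telescoping -/

/-- The partial sums are V m - V 0 over nonnegative indices and V 0 - V (-m) over negative ones;
nonnegativity turns their limits into unconditional sums. -/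
theorem hasSum_int_of_telescoping {V W : ℤ → ℝ} {L : ℝ} (hW : ∀ j, 0 ≤ W j)
    (hV : ∀ j, V (j + 1) = V j + W j) (htop : Tendsto (fun m : ℕ => V m) atTop (𝓝 L))
    (hbot : Tendsto (fun m : ℕ => V (-(m : ℤ))) atTop (𝓝 0)) : HasSum W L := by
  have h1 : HasSum (fun m : ℕ => W m) (L - V 0) := by
    rw [hasSum_iff_tendsto_nat_of_nonneg fun m => hW m]
    refine (htop.sub_const (V 0)).congr fun m => ?_
    induction m with
    | zero => simp
    | succ m ih =>
      rw [Finset.sum_range_succ, ← ih]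
      push_cast
      rw [hV]
      ring
  have h2 : HasSum (fun m : ℕ => W (-((m : ℤ) + 1))) (V 0) := by
    rw [hasSum_iff_tendsto_nat_of_nonneg fun m => hW _]
    have h3 := hbot.const_sub (V 0)
    rw [sub_zero] at h3
    refine h3.congr fun m => ?_
    induction m with
    | zero => simp
    | succ m ih =>
      rw [Finset.sum_range_succ, ← ih]
      have h4 := hV (-((m : ℤ) + 1))
      rw [show -((m : ℤ) + 1) + 1 = -(m : ℤ) by ring] at h4
      push_cast
      rw [h4]
      ring
  have h3 := HasSum.of_nat_of_neg_add_one h1 h2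
  rwa [sub_add_cancel] at h3

/-- Nonnegativity allows summing in any order: over translations for a fixed scale and generator,
then over generators, then over scales. -/
theorem hasSum_prod_fintype {α β γ : Type*} [Fintype γ] {u : α × β × γ → ℝ} (hu : ∀ x, 0 ≤ u x)
    {w : α → γ → ℝ} {L : ℝ} (h : ∀ a c, HasSum (fun b => u (a, b, c)) (w a c))
    (hL : HasSum (fun a => ∑ c, w a c) L) : HasSum u L := by
  have h1 : ∀ a, HasSum (fun x : β × γ => u (a, x)) (∑ c, w a c) := by
    intro a
    have h2 : HasSum (fun x : γ × β => u (a, x.2, x.1)) (∑ c, w a c) := by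
      have h3 : Summable fun x : γ × β => u (a, x.2, x.1) := by
        rw [summable_prod_of_nonneg fun x => hu _]
        exact ⟨fun c => (h a c).summable, (hasSum_fintype _).summable⟩
      have h4 := h3.hasSum.prod_fiberwise fun c => h a c
      rw [← h4.unique (hasSum_fintype _)]
      exact h3.hasSum
    exact (Equiv.prodComm β γ).symm.hasSum_iff.1 h2
  have h2 : Summable u := by
    rw [summable_prod_of_nonneg hu]
    refine ⟨fun a => (h1 a).summable, ?_⟩
    simp only [fun a => (h1 a).tsum_eq]
    exact hL.summable
  have h3 := h2.hasSum.prod_fiberwise h1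
  rw [← h3.unique hL]
  exact h2.hasSum

/-! ### The coefficients of the affine system on the Fourier side -/

/-- Plancherel, followed by applying the same unitary dilation to both arguments: it undoes the
dilation on the left and moves it onto `F`. -/
theorem inner_dilation_translation {n : ℕ} (A : Rn n ≃ₗ[ℝ] Rn n) (j : ℤ) (k : Fin n → ℤ)
    (ψ f : L2 n) {g F : Rn n → ℂ} (hg : g =ᵐ[volume] (𝓕 ψ : L2 n))
    (hF : F =ᵐ[volume] (𝓕 f : L2 n)) :
    inner ℂ ((dilation A ^ j) (translation (intVec k) ψ)) f
      = ∫ t, character (intVec k) t *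
        (starRingEnd ℂ (g t) * dilateFun (adjointEquiv A ^ j) F t) := by
  rw [← Lp.inner_fourier_eq, ← (dilation (adjointEquiv A) ^ j).inner_map_map,
    fourier_dilation_zpow, L2.inner_def]
  refine integral_congr_ae ?_
  rw [dilation_zpow]
  filter_upwards [fourier_translation (intVec k) ψ, hg,
    coeFn_dilation (adjointEquiv A ^ j) (𝓕 f : L2 n),
    dilateFun_congr (adjointEquiv A ^ j) hF] with t h1 h2 h3 h4
  have h3' : dilation (adjointEquiv A ^ j) (𝓕 f : L2 n) t
    = dilateFun (adjointEquiv A ^ j) (𝓕 f : L2 n) t := h3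
  rw [h1, h3', ← h4, ← h2, RCLike.inner_apply, map_mul, conj_character, neg_neg]
  ring

theorem hasSum_inner_dilation_translation {n : ℕ} (A : Rn n ≃ₗ[ℝ] Rn n) (j : ℤ)
    (ψ f : L2 n) {g F : Rn n → ℂ} (hg : g =ᵐ[volume] (𝓕 ψ : L2 n))
    (hF : F =ᵐ[volume] (𝓕 f : L2 n)) (hFcont : Continuous F) (hFc : HasCompactSupport F) :
    HasSum (fun k : Fin n → ℤ =>
      ‖inner ℂ ((dilation A ^ j) (translation (intVec k) ψ)) f‖ ^ 2)
      (latticeEnergy g (dilateFun (adjointEquiv A ^ j) F)).re := by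
  have hgL : MemLp g 2 volume := (memLp_congr_ae hg).2 (Lp.memLp _)
  have h := Complex.hasSum_re (hasSum_latticeEnergy hgL
    (continuous_dilateFun (adjointEquiv A ^ j) hFcont)
    (hasCompactSupport_dilateFun (adjointEquiv A ^ j) hFc))
  simpa only [Complex.ofReal_re, inner_dilation_translation A j _ ψ f hg hF] using h

theorem dilateFun_dilateFun {n : ℕ} (S T : Rn n ≃ₗ[ℝ] Rn n) (F : Rn n → ℂ) :
    dilateFun T (dilateFun S F) = dilateFun (S * T) F := by
  funext t
  simp only [dilateFun, LinearEquiv.mul_apply]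
  rw [absDet_mul, Real.sqrt_mul (absDet_pos _).le, ← mul_assoc, ← Complex.ofReal_mul,
    mul_comm (Real.sqrt _)]

theorem inner_dilation_neg_pow {n : ℕ} (A : Rn n ≃ₗ[ℝ] Rn n) (m : ℕ) (x f : L2 n) :
    inner ℂ ((dilation A ^ (-(m : ℤ))) x) f = inner ℂ x ((dilation A ^ m) f) := by
  rw [← (dilation A ^ m).inner_map_map ((dilation A ^ (-(m : ℤ))) x) f]
  congr 1
  have h : dilation A ^ m * dilation A ^ (-(m : ℤ)) = 1 := by
    rw [zpow_neg, zpow_natCast, mul_inv_cancel]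
  exact congrArg (fun U : L2 n ≃ₗᵢ[ℂ] L2 n => U x) h

/-- **The unitary extension principle**, for masks indexed by `Option (Fin N)` and with the cross
identities stated for all nonlattice points of the inverse image of the lattice. -/
theorem unitary_extension {n N : ℕ} (hn : 0 < n)
    (A : Rn n →ₗ[ℝ] Rn n) (hA : IsExpansive A)
    (hAZ : ∀ k ∈ intLattice n, A k ∈ intLattice n)
    (φ : L2 n) (g : Rn n → ℂ)
    (hg : g =ᵐ[volume] (𝓕 φ : L2 n)) (hg0 : ‖g 0‖ = 1)
    (hcont : IsApproxContinuousAt (LinearMap.adjoint A) (fun t => ‖g t‖) 0)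
    (m : Option (Fin N) → Rn n → ℂ)
    (hm : ∀ i (k : Fin n → ℤ) t, m i (t + intVec k) = m i t)
    (hrefin : ∀ᵐ t, g (LinearMap.adjoint A t) = m none t * g t)
    (hdiag : ∀ᵐ t, g t ≠ 0 → ∑ i, m i t * starRingEnd ℂ (m i t) = 1)
    (hcross : ∀ y, LinearMap.adjoint A y ∈ intLattice n → y ∉ intLattice n →
      ∀ᵐ t, g t ≠ 0 → g (t + y) ≠ 0 → ∑ i, m i t * starRingEnd ℂ (m i (t + y)) = 0)
    (ψ : Fin N → L2 n)
    (hψ : ∀ l, ∀ᵐ t, (𝓕 (ψ l) : L2 n) (LinearMap.adjoint A t) = m (some l) t * g t) :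
    IsParsevalWaveletFrame hA.toLinearEquiv ψ := by
  set A' := hA.toLinearEquiv with hA'
  set T := adjointEquiv A' with hT
  have hTA : ∀ t, T t = LinearMap.adjoint A t := fun t => rfl
  have hT0 : Tendsto (fun j : ℕ => toCLM T.symm ^ j) atTop (𝓝 0) := hA.tendsto_adjoint_symm_pow
  have hgL : MemLp g 2 volume := (memLp_congr_ae hg).2 (Lp.memLp _)
  -- the modulus of `g` decreases along orbits
  have hmono : ∀ᵐ t, ‖g (T t)‖ ≤ ‖g t‖ := by
    filter_upwards [hrefin, hdiag] with t h1 h2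
    rw [hTA, h1, norm_mul]
    by_cases hgt : g t = 0
    · simp [hgt]
    · refine mul_le_of_le_one_left (norm_nonneg _) ?_
      have h3 : ∑ i, ‖m i t‖ ^ 2 = 1 := by
        have h4 := h2 hgt
        simp only [← Complex.normSq_eq_conj_mul_self, mul_comm (m _ t),
          Complex.normSq_eq_norm_sq] at h4
        exact_mod_cast h4
      have h5 : ‖m none t‖ ^ 2 ≤ 1 := by
        rw [← h3]
        exact Finset.single_le_sum (f := fun i => ‖m i t‖ ^ 2) (fun i _ => by positivity)
          (Finset.mem_univ none)
      exact (sq_le_one_iff₀ (norm_nonneg _)).1 h5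
  have hlim := ae_tendsto_symm_pow T hT0 (a := fun t => ‖g t‖) hcont hmono
  simp only [hg0] at hlim
  -- one dilation step
  set G : Option (Fin N) → Rn n → ℂ := fun i => i.elim g fun l => (𝓕 (ψ l) : L2 n) with hG
  have hGL : ∀ i, MemLp (G i) 2 volume := by
    rintro (_ | l)
    · exact hgL
    · exact Lp.memLp _
  have hGm : ∀ i, ∀ᵐ t, G i (T t) = m i t * g t := by
    rintro (_ | l)
    · exact hrefin
    · exact hψ l
  have hTZ : ∀ k : Fin n → ℤ, T (intVec k) ∈ intLattice n := adjoint_mem_intLattice hAZ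
  have hstep : ∀ {F : Rn n → ℂ}, Continuous F → HasCompactSupport F → ∀ j : ℤ,
      latticeEnergy g (dilateFun (T ^ (j + 1)) F) = latticeEnergy g (dilateFun (T ^ j) F) +
        ∑ l, latticeEnergy (𝓕 (ψ l) : L2 n) (dilateFun (T ^ j) F) := by
    intro F hF hFc j
    have h1 := sum_latticeEnergy_eq T hTZ hGL (continuous_dilateFun (T ^ j) hF)
      (hasCompactSupport_dilateFun (T ^ j) hFc) hGm hm hdiag hcross
    rw [dilateFun_dilateFun, ← zpow_add_one, Fintype.sum_option] at h1
    exact h1.symm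
  -- the dense set
  set D : Set (L2 n) := {f | (𝓕 f : L2 n) ∈ contCompact n} with hD
  have hDdense : Dense D :=
    (dense_contCompact n).preimage (Lp.fourierTransformₗᵢ (Rn n) ℂ).toHomeomorph.isOpenMap
  have hWnonneg : ∀ {f : L2 n} {F : Rn n → ℂ}, Continuous F → HasCompactSupport F →
      F =ᵐ[volume] (𝓕 f : L2 n) → ∀ (j : ℤ) l,
      0 ≤ (latticeEnergy (𝓕 (ψ l) : L2 n) (dilateFun (T ^ j) F)).re := fun hF hFc hFf j l =>
    (hasSum_inner_dilation_translation A' j (ψ l) _ EventuallyEq.rfl hFf hF hFc).nonneg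
      fun _ => by positivity
  have hVstep : ∀ {F : Rn n → ℂ}, Continuous F → HasCompactSupport F → ∀ j : ℤ,
      (latticeEnergy g (dilateFun (T ^ (j + 1)) F)).re =
        (latticeEnergy g (dilateFun (T ^ j) F)).re +
        ∑ l, (latticeEnergy (𝓕 (ψ l) : L2 n) (dilateFun (T ^ j) F)).re := by
    intro F hF hFc j
    rw [hstep hF hFc j, Complex.add_re, Complex.re_sum]
  have hVtop : ∀ {f : L2 n} {F : Rn n → ℂ}, Continuous F → HasCompactSupport F →
      F =ᵐ[volume] (𝓕 f : L2 n) → Tendsto (fun j : ℕ =>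
        (latticeEnergy g (dilateFun (T ^ (j : ℤ)) F)).re) atTop (𝓝 (‖f‖ ^ 2)) := by
    intro f F hF hFc hFf
    have h1 := tendsto_latticeEnergy_dilateFun T hT0 hgL.1 hlim hF hFc
    have h2 : ∫ t, ((‖F t‖ ^ 2 : ℝ) : ℂ) = ((‖f‖ ^ 2 : ℝ) : ℂ) := by
      rw [← Lp.norm_fourier_eq f, integral_complex_ofReal]
      congr 1
      rw [← inner_self_eq_norm_sq (𝕜 := ℂ), L2.inner_def, ← integral_re (L2.integrable_inner _ _)]
      refine integral_congr_ae ?_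
      filter_upwards [hFf] with t ht
      rw [← ht, inner_self_eq_norm_sq]
    rw [h2] at h1
    exact (Complex.continuous_re.tendsto _).comp h1
  -- the integer translates of `φ` form a Bessel family
  have hbessel : IsBessel fun k : Fin n → ℤ => translation (intVec k) φ := by
    refine isBessel_of_dense hDdense ?_
    rintro f ⟨F, hF, hFc, hFf⟩
    have h1 := hasSum_inner_dilation_translation A' 0 φ f hg hFf hF hFc
    refine ⟨_, ?_, h1⟩
    -- The energies increase with the scale to ‖f‖², so the one at scale 0 is at most ‖f‖².
    have h2 : Monotone fun j : ℕ => (latticeEnergy g (dilateFun (T ^ (j : ℤ)) F)).re := by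
      refine monotone_nat_of_le_succ fun j => ?_
      push_cast
      rw [hVstep hF hFc]
      exact le_add_of_nonneg_right (Finset.sum_nonneg fun l _ => hWnonneg hF hFc hFf j l)
    exact h2.ge_of_tendsto (hVtop hF hFc hFf) 0
  -- Decay is known for compactly supported `f`, whereas `D` constrains the transform of `f`; the
  -- Bessel bound carries the decay to every `f`.
  have hVbot : ∀ f : L2 n, Tendsto (fun m : ℕ => ∑' k : Fin n → ℤ,
      ‖inner ℂ (translation (intVec k) φ) ((dilation A' ^ m) f)‖ ^ 2) atTop (𝓝 0) :=
    hbessel.tendsto_of_dense (fun m => (dilation A' ^ m).toLinearIsometry) (dense_contCompact n)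
      fun f hf => tendsto_tsum_inner_translation hn A' hA.tendsto_symm_pow φ hf
  refine isParsevalFrame_of_dense hDdense ?_
  rintro f ⟨F, hF, hFc, hFf⟩
  refine hasSum_prod_fintype (fun _ => by positivity)
    (fun j l => hasSum_inner_dilation_translation A' j (ψ l) f EventuallyEq.rfl hFf hF hFc) ?_
  refine hasSum_int_of_telescoping (V := fun j => (latticeEnergy g (dilateFun (T ^ j) F)).re)
    (fun j => Finset.sum_nonneg fun l _ => hWnonneg hF hFc hFf j l)
    (hVstep hF hFc) (hVtop hF hFc hFf) ((hVbot f).congr fun m => ?_)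
  rw [← (hasSum_inner_dilation_translation A' (-(m : ℤ)) φ f hg hFf hF hFc).tsum_eq]
  exact tsum_congr fun k => by rw [inner_dilation_neg_pow]

end Wavelet

/-! ### The principle in terms of null sets and coset representatives -/

theorem mainTheorem4 {n N : ℕ} (hn : 0 < n)
    -- an expansive dilation preserving the integer lattice
    (A : Wavelet.Rn n →ₗ[ℝ] Wavelet.Rn n) (hA : Wavelet.IsExpansive A)
    (hAZ : ∀ k ∈ Wavelet.intLattice n, A k ∈ Wavelet.intLattice n)
    -- representatives of the cosets of the inverse image of the lattice under the adjoint
    (Γ : Set (Wavelet.Rn n))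
    (hΓ : Wavelet.IsCosetRepresentatives (LinearMap.adjoint A) Γ)
    -- a square-integrable function, and a representative of its Fourier transform
    (φ : Wavelet.L2 n) (φhat : Wavelet.Rn n → ℂ)
    (hφhat : φhat =ᵐ[volume] (𝓕 φ : Wavelet.L2 n))
    (hφ_zero : ‖φhat 0‖ = 1)
    (hφ_cont : Wavelet.IsApproxContinuousAt (LinearMap.adjoint A) (fun t => ‖φhat t‖) 0)
    -- the masks
    (H₀ : Wavelet.Rn n → ℂ) (hH₀ : Wavelet.IsMask H₀)
    (hrefin : ∀ᵐ t, φhat (LinearMap.adjoint A t) = H₀ t * φhat t)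
    (H : Fin N → Wavelet.Rn n → ℂ) (hH : ∀ l, Wavelet.IsMask (H l))
    -- the unitary extension identities
    (hUEP_diag : ∀ᵐ t, t ∉ Wavelet.nullSet φhat →
      ‖H₀ t‖ ^ 2 + ∑ l, ‖H l t‖ ^ 2 = 1)
    (hUEP_cross : ∀ᵐ t, t ∉ Wavelet.nullSet φhat →
      ∀ p ∈ Γ, p ≠ 0 → t + p ∉ Wavelet.nullSet φhat →
        H₀ t * starRingEnd ℂ (H₀ (t + p)) + ∑ l, H l t * starRingEnd ℂ (H l (t + p)) = 0)
    -- the generators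
    (ψ : Fin N → Wavelet.L2 n)
    (hψ : ∀ l, ∀ᵐ t, (𝓕 (ψ l) : Wavelet.L2 n) (LinearMap.adjoint A t) = H l t * φhat t) :
    Wavelet.IsParsevalWaveletFrame hA.toLinearEquiv ψ := by
  -- The masks form one family with `H₀` at `none`. A point where `φhat` is nonzero lies outside the
  -- null set, by the k = 0 term of the bracket, and the identities are needed only at such points.
  have hdiag' : ∀ᵐ t, φhat t ≠ 0 →
      ∑ i : Option (Fin N), i.elim H₀ H t * starRingEnd ℂ (i.elim H₀ H t) = 1 := by
    filter_upwards [hUEP_diag] with t ht h0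
    have h1 := ht (Wavelet.notMem_nullSet_of_ne_zero h0)
    rw [Fintype.sum_option]
    simp only [Option.elim, mul_comm _ (starRingEnd ℂ _), ← Complex.normSq_eq_conj_mul_self,
      Complex.normSq_eq_norm_sq]
    exact_mod_cast h1
  have hper : ∀ (i : Option (Fin N)) (k : Fin n → ℤ) t,
      i.elim H₀ H (t + Wavelet.intVec k) = i.elim H₀ H t := by
    rintro (_ | l) k t
    · exact hH₀.2 k t
    · exact (hH l).2 k t
  refine Wavelet.unitary_extension hn A hA hAZ φ φhat hφhat hφ_zero hφ_cont
    (fun i => i.elim H₀ H) hper hrefin hdiag' (Wavelet.cross_of_isCosetRepresentatives hΓ hper ?_) ψ hψ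
  filter_upwards [hUEP_cross] with t ht h0 p hp hp0 hp1
  rw [Fintype.sum_option]
  exact ht h0 p hp hp0 hp1
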